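/- Let $X$ be a real random variable with $E X^8<\infty$, mean $\mu=E X$ and central moments $\mu_k=E(X-\mu)^k$, and let $q(x)=\delta(x-\mu)^2+\beta(x-\mu)+\gamma$ with real $\delta,\beta,\gamma$. Assume one of the following. (a) (Discrete case) $X$ is integer-valued, its probability mass function $p$ is positive at at least three integers, and $\sum_{k\le j}(\mu-k)p(k)=q(j)p(j)$ for all $j\in\mathbb Z$. (b) (Continuous case) $X$ has a probability density $f\ge 0$ with $\int_{-\infty}^x(\mu-t)f(t)\,dt=q(x)f(x)$ for all $x\in\mathbb R$. Let $X_1,X_2,\dots$ be independent copies of $X$, $\overline X_n=\frac1n\sum_{j=1}^nX_j$, $m_k=m_{k;n}=\frac1n\sum_{j=1}^n(X_j-\overline X_n)^k$ and $\widehat\Theta_n=m_4m_2-m_3^2-m_2^3$. Let $\mathbf q_n=(\overline X_n,\widehat\delta_n,\widehat\beta_n,\widehat\gamma_n)^t$ be the random vector which, almost surely whenever at least three distinct values occur in $X_1,\dots,X_n$, is given in case (a) by $$\widehat\delta_n=\frac{2m_4m_2-3m_3^2-6m_2^3+m_2^2}{6\widehat\Theta_n},\quad \widehat\beta_n=\frac{m_4m_3-3m_4m_2+3m_3^2+3m_3m_2^2-m_3m_2+3m_2^3}{6\widehat\Theta_n},\quad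 \widehat\gamma_n=\frac{4m_4m_2^2-3m_3^2m_2-m_2^3}{6\widehat\Theta_n},$$ and in case (b) by $$\widehat\delta_n=\frac{2m_4m_2-3m_3^2-6m_2^3}{6\widehat\Theta_n},\quad \widehat\beta_n=\frac{m_4m_3+3m_3m_2^2}{6\widehat\Theta_n},\quad \widehat\gamma_n=\frac{4m_4m_2^2-3m_3^2m_2}{6\widehat\Theta_n}$$ (on the remaining event $\mathbf q_n$ is arbitrary, but measurable). Then $$\sqrt n\,\big(\mathbf q_n-(\mu,\delta,\beta,\gamma)^t\big)\ \longrightarrow\ N_4(\mathbf 0,\mathbb D)\quad\text{in law as } n\to\infty,\qquad \mathbb D=(J_\varphi J_\psi)\,\Sigma\,(J_\varphi J_\psi)^t ,$$ where $\mathbb D$ is positive semidefinite, $\Sigma=(\mu_{i+j}-\mu_i\mu_j)_{1\le i,j\le4}$ (with $\mu_1=0$), $$J_\psi=\begin{pmatrix}1&0&0&0\\0&1&0&0\\-3\mu_2&0&1&0\\-4\mu_3&0&0&1\end{pmatrix},$$ and, with $\Theta=\mu_4\mu_2-\mu_3^2-\mu_2^3$, the matrix $6\Theta^2J_\varphi=(j_{kl})$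 has $j_{11}=6\Theta^2$, $j_{12}=j_{13}=j_{14}=j_{21}=j_{31}=j_{41}=0$ and the following further entries. Case (a): - $j_{22}=\mu_4\mu_3^2-8\mu_4\mu_2^3+\mu_4\mu_2^2+9\mu_3^2\mu_2^2-2\mu_3^2\mu_2+\mu_2^4$, - $j_{23}=-2\mu_4\mu_3\mu_2-6\mu_3\mu_2^3+2\mu_3\mu_2^2$, - $j_{24}=\mu_3^2\mu_2+4\mu_2^4-\mu_2^3$, - $j_{32}=-\mu_4^2\mu_3+6\mu_4\mu_3\mu_2^2-6\mu_3^3\mu_2+\mu_3^3+3\mu_3\mu_2^4-2\mu_3\mu_2^3$, - $j_{33}=\mu_4^2\mu_2+\mu_4\mu_3^2+2\mu_4\mu_2^3-\mu_4\mu_2^2+3\mu_3^2\mu_2^2-\mu_3^2\mu_2-3\mu_2^5+\mu_2^4$, - $j_{34}=-\mu_3^3-4\mu_3\mu_2^3+\mu_3\mu_2^2$, - $j_{42}=4\mu_4^2\mu_2^2-8\mu_4\mu_3^2\mu_2+4\mu_4\mu_2^4-2\mu_4\mu_2^3+3\mu_3^4-6\mu_3^2\mu_2^3+3\mu_3^2\mu_2^2$,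 - $j_{43}=2\mu_4\mu_3\mu_2^2+6\mu_3\mu_2^4-2\mu_3\mu_2^3$, - $j_{44}=-\mu_3^2\mu_2^2-4\mu_2^5+\mu_2^4$. Case (b): - $j_{22}=\mu_4\mu_3^2-8\mu_4\mu_2^3+9\mu_3^2\mu_2^2$, - $j_{23}=-2\mu_4\mu_3\mu_2-6\mu_3\mu_2^3$, - $j_{24}=\mu_3^2\mu_2+4\mu_2^4$, - $j_{32}=-\mu_4^2\mu_3+6\mu_4\mu_3\mu_2^2-6\mu_3^3\mu_2+3\mu_3\mu_2^4$, - $j_{33}=\mu_4^2\mu_2+\mu_4\mu_3^2+2\mu_4\mu_2^3+3\mu_3^2\mu_2^2-3\mu_2^5$, - $j_{34}=-\mu_3^3-4\mu_3\mu_2^3$, - $j_{42}=4\mu_4^2\mu_2^2-8\mu_4\mu_3^2\mu_2+4\mu_4\mu_2^4+3\mu_3^4-6\mu_3^2\mu_2^3$, - $j_{43}=2\mu_4\mu_3\mu_2^2+6\mu_3\mu_2^4$, - $j_{44}=-\mu_3^2\mu_2^2-4\mu_2^5$. Moreover, these matrices are the Jacobians that the notation indicates: $J_\psi$ is the total derivative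 at $(0,\mu_2,\mu_3,\mu_4)$ of $\psi(x)=(x_1,\;x_2-x_1^2,\;x_3-3x_2x_1+2x_1^3,\;x_4-4x_3x_1+6x_2x_1^2-3x_1^4)$, and $J_\varphi$ is the total derivative at $(\mu,\mu_2,\mu_3,\mu_4)$ of the map $\varphi$ taking $(\overline X_n,m_2,m_3,m_4)$ to $(\overline X_n,\widehat\delta_n,\widehat\beta_n,\widehat\gamma_n)$ by the formulas of the case in question. -/

import Mathlib

open MeasureTheory ProbabilityTheory Filter Topology

noncomputable section

namespace Pearson

/-- The quadratic `q(x) = δ (x - μ)² + β (x - μ) + γ`. -/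
def quadratic (μ δ β γ x : ℝ) : ℝ := δ * (x - μ) ^ 2 + β * (x - μ) + γ

/-- Probability mass function of an integer-valued real random variable. -/
def pmf {Ω : Type*} [MeasurableSpace Ω] (P : Measure Ω) (X : Ω → ℝ) (j : ℤ) : ℝ :=
  P.real {ω | X ω = (j : ℝ)}

/-- `X` is an integer-valued random variable with finite mean `μ`, whose support has at least three
points, and whose mass function `p` satisfies
`∑_{k ≤ j} (μ - k) p(k) = q(j) p(j)` for all integers `j`. -/
structure DiscreteForm {Ω : Type*} [MeasurableSpace Ω] (P : Measure Ω) (X : Ω → ℝ)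
    (δ β γ : ℝ) : Prop where
  integrable : Integrable X P
  integer_valued : ∀ᵐ ω ∂P, ∃ j : ℤ, X ω = (j : ℝ)
  three_le_support : 3 ≤ {j : ℤ | 0 < pmf P X j}.encard
  identity : ∀ j : ℤ, HasSum (fun k : Set.Iic j => (P[X] - ((k : ℤ) : ℝ)) * pmf P X k)
    (quadratic P[X] δ β γ j * pmf P X j)

/-- `X` is a continuous random variable with finite mean `μ` and with density `f` satisfying
`∫_{-∞}^x (μ - t) f(t) dt = q(x) f(x)` for all real `x`. -/
structure ContinuousForm {Ω : Type*} [MeasurableSpace Ω] (P : Measure Ω) (X : Ω → ℝ)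
    (f : ℝ → ℝ) (δ β γ : ℝ) : Prop where
  integrable : Integrable X P
  measurable_density : Measurable f
  density_nonneg : ∀ x, 0 ≤ f x
  map_eq : P.map X = volume.withDensity (fun x => ENNReal.ofReal (f x))
  identity : ∀ x : ℝ, ∫ t in Set.Iic x, (P[X] - t) * f t = quadratic P[X] δ β γ x * f x

/-- Sample mean of the first `n` observations. -/
def sampleMean {Ω : Type*} (S : ℕ → Ω → ℝ) (n : ℕ) (ω : Ω) : ℝ :=
  (∑ i ∈ Finset.range n, S i ω) / n

/-- `k`-th sample central moment of the first `n` observations. -/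
def sampleCentralMoment {Ω : Type*} (S : ℕ → Ω → ℝ) (k n : ℕ) (ω : Ω) : ℝ :=
  (∑ i ∈ Finset.range n, (S i ω - sampleMean S n ω) ^ k) / n

/-- The vector of the sample mean and the second, third and fourth sample central moments. -/
def sampleVector {Ω : Type*} (S : ℕ → Ω → ℝ) (n : ℕ) (ω : Ω) : EuclideanSpace ℝ (Fin 4) :=
  !₂[sampleMean S n ω, sampleCentralMoment S 2 n ω, sampleCentralMoment S 3 n ω,
    sampleCentralMoment S 4 n ω]

/-- At least three distinct values occur among the first `n` observations. -/
def ThreeDistinct {Ω : Type*} (S : ℕ → Ω → ℝ) (n : ℕ) (ω : Ω) : Prop :=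
  3 ≤ ((fun i => S i ω) '' Set.Iio n).ncard

/-- `Θ = m₄ m₂ - m₃² - m₂³`. -/
def theta (m₂ m₃ m₄ : ℝ) : ℝ := m₄ * m₂ - m₃ ^ 2 - m₂ ^ 3

/-- Discrete case: the map taking (mean, central moments of orders 2, 3, 4) to
`(μ, δ, β, γ)`. -/
def phiDiscrete (x : EuclideanSpace ℝ (Fin 4)) : EuclideanSpace ℝ (Fin 4) :=
  let m₂ := x 1
  let m₃ := x 2
  let m₄ := x 3
  !₂[x 0,
    (2 * m₄ * m₂ - 3 * m₃ ^ 2 - 6 * m₂ ^ 3 + m₂ ^ 2) / (6 * theta m₂ m₃ m₄),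
    (m₄ * m₃ - 3 * m₄ * m₂ + 3 * m₃ ^ 2 + 3 * m₃ * m₂ ^ 2 - m₃ * m₂ + 3 * m₂ ^ 3)
      / (6 * theta m₂ m₃ m₄),
    (4 * m₄ * m₂ ^ 2 - 3 * m₃ ^ 2 * m₂ - m₂ ^ 3) / (6 * theta m₂ m₃ m₄)]

/-- Continuous case: the map taking (mean, central moments of orders 2, 3, 4) to
`(μ, δ, β, γ)`. -/
def phiContinuous (x : EuclideanSpace ℝ (Fin 4)) : EuclideanSpace ℝ (Fin 4) :=
  let m₂ := x 1
  let m₃ := x 2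
  let m₄ := x 3
  !₂[x 0,
    (2 * m₄ * m₂ - 3 * m₃ ^ 2 - 6 * m₂ ^ 3) / (6 * theta m₂ m₃ m₄),
    (m₄ * m₃ + 3 * m₃ * m₂ ^ 2) / (6 * theta m₂ m₃ m₄),
    (4 * m₄ * m₂ ^ 2 - 3 * m₃ ^ 2 * m₂) / (6 * theta m₂ m₃ m₄)]

/-- The map taking moments about a point to (first moment about it, central moments of
orders 2, 3, 4). -/
def psi (x : EuclideanSpace ℝ (Fin 4)) : EuclideanSpace ℝ (Fin 4) :=
  !₂[x 0, x 1 - x 0 ^ 2, x 2 - 3 * x 1 * x 0 + 2 * x 0 ^ 3,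
    x 3 - 4 * x 2 * x 0 + 6 * x 1 * x 0 ^ 2 - 3 * x 0 ^ 4]

/-- The matrix `J_ψ`. -/
def jPsi (μ₂ μ₃ : ℝ) : Matrix (Fin 4) (Fin 4) ℝ :=
  !![1, 0, 0, 0;
    0, 1, 0, 0;
    -3 * μ₂, 0, 1, 0;
    -4 * μ₃, 0, 0, 1]

/-- The matrix `J_φ` in the discrete case. -/
def jPhiDiscrete (μ₂ μ₃ μ₄ : ℝ) : Matrix (Fin 4) (Fin 4) ℝ :=
  (6 * theta μ₂ μ₃ μ₄ ^ 2)⁻¹ •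
  !![6 * theta μ₂ μ₃ μ₄ ^ 2, 0, 0, 0;
    0,
    μ₄ * μ₃ ^ 2 - 8 * μ₄ * μ₂ ^ 3 + μ₄ * μ₂ ^ 2 + 9 * μ₃ ^ 2 * μ₂ ^ 2 - 2 * μ₃ ^ 2 * μ₂ + μ₂ ^ 4,
    -2 * μ₄ * μ₃ * μ₂ - 6 * μ₃ * μ₂ ^ 3 + 2 * μ₃ * μ₂ ^ 2,
    μ₃ ^ 2 * μ₂ + 4 * μ₂ ^ 4 - μ₂ ^ 3;
    0,
    -μ₄ ^ 2 * μ₃ + 6 * μ₄ * μ₃ * μ₂ ^ 2 - 6 * μ₃ ^ 3 * μ₂ + μ₃ ^ 3 + 3 * μ₃ * μ₂ ^ 4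
      - 2 * μ₃ * μ₂ ^ 3,
    μ₄ ^ 2 * μ₂ + μ₄ * μ₃ ^ 2 + 2 * μ₄ * μ₂ ^ 3 - μ₄ * μ₂ ^ 2 + 3 * μ₃ ^ 2 * μ₂ ^ 2 - μ₃ ^ 2 * μ₂
      - 3 * μ₂ ^ 5 + μ₂ ^ 4,
    -μ₃ ^ 3 - 4 * μ₃ * μ₂ ^ 3 + μ₃ * μ₂ ^ 2;
    0,
    4 * μ₄ ^ 2 * μ₂ ^ 2 - 8 * μ₄ * μ₃ ^ 2 * μ₂ + 4 * μ₄ * μ₂ ^ 4 - 2 * μ₄ * μ₂ ^ 3 + 3 * μ₃ ^ 4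
      - 6 * μ₃ ^ 2 * μ₂ ^ 3 + 3 * μ₃ ^ 2 * μ₂ ^ 2,
    2 * μ₄ * μ₃ * μ₂ ^ 2 + 6 * μ₃ * μ₂ ^ 4 - 2 * μ₃ * μ₂ ^ 3,
    -μ₃ ^ 2 * μ₂ ^ 2 - 4 * μ₂ ^ 5 + μ₂ ^ 4]

/-- The matrix `J_φ` in the continuous case. -/
def jPhiContinuous (μ₂ μ₃ μ₄ : ℝ) : Matrix (Fin 4) (Fin 4) ℝ :=
  (6 * theta μ₂ μ₃ μ₄ ^ 2)⁻¹ •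
  !![6 * theta μ₂ μ₃ μ₄ ^ 2, 0, 0, 0;
    0,
    μ₄ * μ₃ ^ 2 - 8 * μ₄ * μ₂ ^ 3 + 9 * μ₃ ^ 2 * μ₂ ^ 2,
    -2 * μ₄ * μ₃ * μ₂ - 6 * μ₃ * μ₂ ^ 3,
    μ₃ ^ 2 * μ₂ + 4 * μ₂ ^ 4;
    0,
    -μ₄ ^ 2 * μ₃ + 6 * μ₄ * μ₃ * μ₂ ^ 2 - 6 * μ₃ ^ 3 * μ₂ + 3 * μ₃ * μ₂ ^ 4,
    μ₄ ^ 2 * μ₂ + μ₄ * μ₃ ^ 2 + 2 * μ₄ * μ₂ ^ 3 + 3 * μ₃ ^ 2 * μ₂ ^ 2 - 3 * μ₂ ^ 5,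
    -μ₃ ^ 3 - 4 * μ₃ * μ₂ ^ 3;
    0,
    4 * μ₄ ^ 2 * μ₂ ^ 2 - 8 * μ₄ * μ₃ ^ 2 * μ₂ + 4 * μ₄ * μ₂ ^ 4 + 3 * μ₃ ^ 4
      - 6 * μ₃ ^ 2 * μ₂ ^ 3,
    2 * μ₄ * μ₃ * μ₂ ^ 2 + 6 * μ₃ * μ₂ ^ 4,
    -μ₃ ^ 2 * μ₂ ^ 2 - 4 * μ₂ ^ 5]

/-- `Σ = (μ_{i+j} - μ_i μ_j)` for `1 ≤ i, j ≤ 4`, from the central moments `m k = μ_k`. -/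
def sigma (m : ℕ → ℝ) : Matrix (Fin 4) (Fin 4) ℝ :=
  Matrix.of fun i j => m (((i : ℕ) + 1) + ((j : ℕ) + 1)) - m ((i : ℕ) + 1) * m ((j : ℕ) + 1)

/-- `D = (J_φ J_ψ) Σ (J_φ J_ψ)ᵗ`. -/
def asymptoticCovariance (jφ jψ S : Matrix (Fin 4) (Fin 4) ℝ) : Matrix (Fin 4) (Fin 4) ℝ :=
  (jφ * jψ) * S * (jφ * jψ).transpose

/-- `√n (Qₙ - w)` converges in law to the 4-dimensional normal law `N₄(0, D)`. -/
def AsymptoticallyNormal {Ω : Type*} [MeasurableSpace Ω] (P : Measure Ω) [IsProbabilityMeasure P]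
    (Q : ℕ → Ω → EuclideanSpace ℝ (Fin 4)) (w : EuclideanSpace ℝ (Fin 4))
    (D : Matrix (Fin 4) (Fin 4) ℝ) : Prop :=
  D.PosSemidef ∧
  TendstoInDistribution (fun (n : ℕ) ω => √(n : ℝ) • (Q n ω - w)) atTop
    (id : EuclideanSpace ℝ (Fin 4) → EuclideanSpace ℝ (Fin 4)) (fun _ => P)
    (multivariateGaussian 0 D)

end Pearson

end

/-! Test the defining identity of `p` or `f` against `g(x) = (x - μ)^k`, k = 1, 2, 3. Summation or
integration by parts gives a Stein identity, E (X - μ) g(X) = E q(X) Δg(X) or E q(X) g'(X), hence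
three linear equations for δ, β, γ whose coefficients are central moments. The determinant is -6Θ,
and Cramer's rule is exactly the map φ (`phiDiscrete_eq`, `phiContinuous_eq`).

Θ/μ₂ is the squared L² distance from (X - μ)² to the span of 1 and X - μ. It vanishes only if X is
a.s. a root of one quadratic, which three atoms or a density exclude (`theta_centralMoment_pos`). So
φ is differentiable at the true moments.

The sample vector is ψ of averages of powers of X - μ, up to a shift of the first coordinate
(`sampleVector_eq_psi`). The multivariate central limit theorem applies to these averages, with
covariance Σ involving moments up to order 8, and the delta method for φ ∘ ψ turns Σ into 𝔻. Samples
with fewer than three distinct values have Θ̂ = 0 (`theta_sample_eq_zero`), so their probability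
tends to zero and the arbitrary value of the estimator there is harmless. -/

namespace ProbabilityTheory

/-! ### Multivariate central limit theorem -/

open scoped RealInnerProductSpace Matrix

/-- The Cramér–Wold device: it reduces the vector limit theorem to the real one for each projection.
-/
lemma charFun_map_eq_charFun_map_inner {Ω E : Type*} [MeasurableSpace Ω] {P : Measure Ω}
    [NormedAddCommGroup E] [InnerProductSpace ℝ E] [MeasurableSpace E] [BorelSpace E]
    [SecondCountableTopology E] {T : Ω → E} (hT : AEMeasurable T P) (t : E) :
    charFun (P.map T) t = charFun (P.map fun ω => ⟪t, T ω⟫) 1 := by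
  rw [charFun_apply, charFun_apply, integral_map hT (by fun_prop),
    integral_map (by fun_prop) (by fun_prop)]
  simp [real_inner_comm]

lemma dotProduct_mulVec_eq_integral {Ω ι : Type*} [MeasurableSpace Ω] {P : Measure Ω} [Fintype ι]
    {w : Ω → EuclideanSpace ℝ ι} {S : Matrix ι ι ℝ} (hL2 : ∀ i, MemLp (fun ω => w ω i) 2 P)
    (hcov : ∀ i j, ∫ ω, w ω i * w ω j ∂P = S i j) (t : ι → ℝ) :
    t ⬝ᵥ S *ᵥ t = ∫ ω, (∑ i, t i * w ω i) ^ 2 ∂P := by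
  have hprod (i j : ι) : Integrable (fun ω => t i * (t j * (w ω i * w ω j))) P :=
    (((hL2 i).integrable_mul (hL2 j)).const_mul _).const_mul _
  have hsq (ω : Ω) : (∑ i, t i * w ω i) ^ 2 = ∑ i, ∑ j, t i * (t j * (w ω i * w ω j)) := by
    rw [sq, Finset.sum_mul_sum]
    exact Finset.sum_congr rfl fun i _ => Finset.sum_congr rfl fun j _ => by ring
  simp_rw [hsq]
  rw [integral_finsetSum _ fun i _ => integrable_finsetSum _ fun j _ => hprod i j]
  simp_rw [dotProduct, Matrix.mulVec, dotProduct, Finset.mul_sum]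
  refine Finset.sum_congr rfl fun i _ => ?_
  rw [integral_finsetSum _ fun j _ => hprod i j]
  refine Finset.sum_congr rfl fun j _ => ?_
  rw [integral_const_mul, integral_const_mul, hcov]
  ring

lemma posSemidef_of_integral_mul {Ω ι : Type*} [MeasurableSpace Ω] {P : Measure Ω} [Fintype ι]
    {w : Ω → EuclideanSpace ℝ ι} {S : Matrix ι ι ℝ} (hL2 : ∀ i, MemLp (fun ω => w ω i) 2 P)
    (hcov : ∀ i j, ∫ ω, w ω i * w ω j ∂P = S i j) : S.PosSemidef := by
  refine .of_dotProduct_mulVec_nonneg (Matrix.IsHermitian.ext fun i j => ?_) fun t => ?_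
  · simp_rw [star_trivial, ← hcov, mul_comm]
  · rw [star_trivial, dotProduct_mulVec_eq_integral hL2 hcov]
    exact integral_nonneg fun ω => sq_nonneg _

/-- **Multivariate central limit theorem** for centred random vectors. -/
theorem tendstoInDistribution_multivariateGaussian {Ω ι : Type*} [MeasurableSpace Ω]
    {P : Measure Ω} [IsProbabilityMeasure P] [Fintype ι] [DecidableEq ι]
    {W : ℕ → Ω → EuclideanSpace ℝ ι} {S : Matrix ι ι ℝ}
    (hindep : iIndepFun W P) (hident : ∀ i, IdentDistrib (W i) (W 0) P P)
    (hL2 : ∀ i, MemLp (fun ω => W 0 ω i) 2 P) (hmean : ∀ i, ∫ ω, W 0 ω i ∂P = 0)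
    (hcov : ∀ i j, ∫ ω, W 0 ω i * W 0 ω j ∂P = S i j) :
    TendstoInDistribution (fun (n : ℕ) ω => (√(n : ℝ))⁻¹ • ∑ k ∈ Finset.range n, W k ω) atTop
      (id : EuclideanSpace ℝ ι → EuclideanSpace ℝ ι) (fun _ => P) (multivariateGaussian 0 S) where
  forall_aemeasurable n :=
    (Finset.aemeasurable_fun_sum _ fun k _ => (hident k).aemeasurable_fst).fun_const_smul _
  tendsto := by
    have hS : S.PosSemidef := posSemidef_of_integral_mul hL2 hcov
    have hW (k : ℕ) : AEMeasurable (W k) P := (hident k).aemeasurable_fst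
    refine ProbabilityMeasure.tendsto_iff_tendsto_charFun.2 fun t => ?_
    have hinner (ω : Ω) : ⟪t, W 0 ω⟫ = ∑ i, t i * W 0 ω i := by
      simp [PiLp.inner_apply, mul_comm]
    have hint (i : ι) : Integrable (fun ω => W 0 ω i) P := (hL2 i).integrable one_le_two
    have hmean' : ∫ ω, ⟪t, W 0 ω⟫ ∂P = 0 := by
      simp_rw [hinner]
      rw [integral_finsetSum _ fun i _ => (hint i).const_mul _]
      simp [integral_const_mul, hmean]
    have hmem : MemLp (fun ω => ⟪t, W 0 ω⟫) 2 P := by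
      simp_rw [hinner]
      exact memLp_finsetSum _ fun i _ => (hL2 i).const_mul _
    have hvar : Var[fun ω => ⟪t, W 0 ω⟫; P] = t ⬝ᵥ S *ᵥ t := by
      rw [variance_of_integral_eq_zero hmem.aemeasurable hmean']
      simp_rw [dotProduct_mulVec_eq_integral hL2 hcov, hinner]
    have hclt := tendstoInDistribution_inv_sqrt_mul_sum_sub (P := P)
      (X := fun k ω => ⟪t, W k ω⟫) (Y := id)
      (P' := gaussianReal 0 Var[fun ω => ⟪t, W 0 ω⟫; P].toNNReal)
      ⟨aemeasurable_id, Measure.map_id⟩ hmem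
      (hindep.comp (fun _ w => ⟪t, w⟫) fun _ => by fun_prop)
      fun i => (hident i).comp (u := fun w => ⟪t, w⟫) (by fun_prop)
    -- The real limit theorem for ⟪t, W⟫, read at frequency 1, is the vector statement at frequency
    -- t.
    have hlim := ProbabilityMeasure.tendsto_iff_tendsto_charFun.1 hclt.tendsto 1
    simp only [ProbabilityMeasure.coe_mk, hmean', mul_zero, sub_zero, Measure.map_id,
      charFun_gaussianReal, hvar] at hlim ⊢
    have hnn : 0 ≤ t ⬝ᵥ S *ᵥ t := hvar ▸ variance_nonneg _ _
    rw [charFun_multivariateGaussian hS]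
    convert! hlim using 2 with n
    · rw [charFun_map_eq_charFun_map_inner
        ((Finset.aemeasurable_fun_sum _ fun k _ => hW k).fun_const_smul _)]
      simp [inner_smul_right, inner_sum]
    · simp [Real.coe_toNNReal _ hnn]

/-- Characteristic functions again: ⟪t, A x⟫ = ⟪Aᵀ t, x⟫, so the quadratic form of S is evaluated at
Aᵀ t. -/
lemma map_toEuclideanCLM_multivariateGaussian {ι : Type*} [Fintype ι] [DecidableEq ι]
    {S : Matrix ι ι ℝ} (hS : S.PosSemidef) (A : Matrix ι ι ℝ) :
    (multivariateGaussian 0 S).map (Matrix.toEuclideanCLM (𝕜 := ℝ) A) =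
      multivariateGaussian 0 (A * S * Aᵀ) := by
  have hD : (A * S * Aᵀ).PosSemidef := by simpa using hS.mul_mul_conjTranspose_same A
  refine Measure.ext_of_charFun (funext fun t => ?_)
  have h : charFun ((multivariateGaussian 0 S).map (Matrix.toEuclideanCLM (𝕜 := ℝ) A)) t =
      charFun (multivariateGaussian 0 S) (Matrix.toEuclideanCLM (𝕜 := ℝ) Aᵀ t) := by
    rw [charFun_apply, charFun_apply, integral_map (by fun_prop) (by fun_prop)]
    congr! 5 with x
    simp [EuclideanSpace.inner_eq_star_dotProduct, Matrix.dotProduct_mulVec,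
      Matrix.mulVec_transpose]
  rw [h, charFun_multivariateGaussian hS, charFun_multivariateGaussian hD]
  simp [Matrix.dotProduct_mulVec, ← Matrix.mulVec_mulVec, Matrix.mulVec_transpose]

end ProbabilityTheory

/-! ### Convergence in law and the delta method -/

namespace MeasureTheory

/-- Only the law of the limit matters; this later replaces a linear image of a Gaussian by the
Gaussian with covariance 𝔻. -/
lemma TendstoInDistribution.of_map_eq {Ω Ω' Ω'' E : Type*} [MeasurableSpace Ω]
    [MeasurableSpace Ω'] [MeasurableSpace Ω''] {P : Measure Ω} [IsProbabilityMeasure P]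
    {P' : Measure Ω'} [IsProbabilityMeasure P'] {P'' : Measure Ω''} [IsProbabilityMeasure P'']
    [TopologicalSpace E] [MeasurableSpace E] [OpensMeasurableSpace E] {ι : Type*} {l : Filter ι}
    {T : ι → Ω → E} {Z : Ω' → E} {W : Ω'' → E}
    (h : TendstoInDistribution T l Z (fun _ => P) P') (hW : AEMeasurable W P'')
    (hZW : P'.map Z = P''.map W) : TendstoInDistribution T l W (fun _ => P) P'' where
  forall_aemeasurable := h.forall_aemeasurable
  aemeasurable_limit := hW
  tendsto := by
    convert! h.tendsto using 2
    exact congrArg 𝓝 (Subtype.ext hZW.symm)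

/-- A sequence converging in distribution is bounded in probability. -/
lemma TendstoInDistribution.exists_measure_le_norm_lt {Ω Ω' E : Type*} [MeasurableSpace Ω]
    [MeasurableSpace Ω'] {P : Measure Ω} [IsProbabilityMeasure P] {P' : Measure Ω'}
    [IsProbabilityMeasure P'] [NormedAddCommGroup E] [MeasurableSpace E] [BorelSpace E]
    {T : ℕ → Ω → E} {Z : Ω' → E} (h : TendstoInDistribution T atTop Z (fun _ => P) P')
    {η : ENNReal} (hη : 0 < η) : ∃ K : ℝ, 0 < K ∧ ∀ᶠ n in atTop, P {ω | K ≤ ‖T n ω‖} < η := by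
  have hK : ∃ K : ℝ, 0 < K ∧ P'.map Z {x | K ≤ ‖x‖} < η := by
    have : IsProbabilityMeasure (P'.map Z) := Measure.isProbabilityMeasure_map h.aemeasurable_limit
    -- Tails of a single law decrease to the empty set; the summand 1 keeps the radius positive.
    have hlim : Tendsto (fun k : ℕ => P'.map Z {x | (k : ℝ) + 1 ≤ ‖x‖}) atTop (𝓝 0) := by
      have hempty : ⋂ k : ℕ, {x : E | (k : ℝ) + 1 ≤ ‖x‖} = ∅ := by
        ext x
        obtain ⟨k, hk⟩ := exists_nat_gt ‖x‖
        simp only [Set.mem_iInter, Set.mem_ofPred_eq, Set.mem_empty_iff_false, iff_false,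
          not_forall]
        exact ⟨k, by linarith⟩
      rw [← measure_empty (μ := P'.map Z), ← hempty]
      refine tendsto_measure_iInter_atTop
        (fun k => (measurableSet_le measurable_const measurable_norm).nullMeasurableSet)
        (fun a b hab x hx => ?_) ⟨0, measure_ne_top _ _⟩
      have : (a : ℝ) ≤ b := by exact_mod_cast hab
      simp only [Set.mem_ofPred_eq] at hx ⊢
      linarith
    obtain ⟨k, hk⟩ := (hlim.eventually (gt_mem_nhds hη)).exists
    exact ⟨k + 1, by positivity, hk⟩
  obtain ⟨K, hK0, hK⟩ := hK
  -- Portmanteau for a closed set carries the tail bound from the limit to all large n.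
  have hclosed : IsClosed {x : E | K ≤ ‖x‖} := isClosed_le continuous_const continuous_norm
  have hle := ProbabilityMeasure.limsup_measure_closed_le_of_tendsto h.tendsto hclosed
  refine ⟨K, hK0, (eventually_lt_of_limsup_lt (hle.trans_lt hK)).mono fun n hn => ?_⟩
  rwa [ProbabilityMeasure.coe_mk, Measure.map_apply_of_aemeasurable (h.forall_aemeasurable n)
    hclosed.measurableSet] at hn

/-- If `√n • U n` converges in distribution, then `U n` tends to zero in probability. -/
lemma TendstoInDistribution.tendsto_measure_le_norm_of_sqrt_smul {Ω Ω' E : Type*}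
    [MeasurableSpace Ω]
    [MeasurableSpace Ω'] {P : Measure Ω} [IsProbabilityMeasure P] {P' : Measure Ω'}
    [IsProbabilityMeasure P'] [NormedAddCommGroup E] [NormedSpace ℝ E] [MeasurableSpace E]
    [BorelSpace E] {U : ℕ → Ω → E} {Z : Ω' → E}
    (h : TendstoInDistribution (fun (n : ℕ) ω => √(n : ℝ) • U n ω) atTop Z (fun _ => P) P')
    {r : ℝ} (hr : 0 < r) : Tendsto (fun n => P {ω | r ≤ ‖U n ω‖}) atTop (𝓝 0) := by
  refine ENNReal.tendsto_nhds_zero.2 fun η hη => ?_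
  obtain ⟨K, -, hK⟩ := h.exists_measure_le_norm_lt hη
  have hsqrt : Tendsto (fun n : ℕ => √(n : ℝ)) atTop atTop :=
    Real.tendsto_sqrt_atTop.comp tendsto_natCast_atTop_atTop
  filter_upwards [hK, hsqrt.eventually_ge_atTop (K / r)] with n hn hKn
  refine (measure_mono fun ω hω => ?_).trans hn.le
  simp only [Set.mem_ofPred_eq, norm_smul, Real.norm_eq_abs, abs_of_nonneg (Real.sqrt_nonneg _)]
    at hω ⊢
  rw [div_le_iff₀ hr] at hKn
  exact hKn.trans (mul_le_mul_of_nonneg_left hω (Real.sqrt_nonneg _))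

/-- **Delta method**: `Q n` need only agree with `h (U n)` with probability tending to one. -/
theorem TendstoInDistribution.delta_method {Ω Ω' E F : Type*} [MeasurableSpace Ω]
    [MeasurableSpace Ω'] {P : Measure Ω} [IsProbabilityMeasure P] {P' : Measure Ω'}
    [IsProbabilityMeasure P'] [NormedAddCommGroup E] [NormedSpace ℝ E] [MeasurableSpace E]
    [BorelSpace E] [NormedAddCommGroup F] [NormedSpace ℝ F] [MeasurableSpace F] [BorelSpace F]
    [SecondCountableTopology F]
    {U : ℕ → Ω → E} {Z : Ω' → E} {Q : ℕ → Ω → F} {h : E → F} {L : E →L[ℝ] F}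
    (hU : TendstoInDistribution (fun (n : ℕ) ω => √(n : ℝ) • U n ω) atTop Z (fun _ => P) P')
    (hL : HasFDerivAt h L 0) (hQ : ∀ n, AEMeasurable (Q n) P)
    (hQU : Tendsto (fun n => P {ω | Q n ω ≠ h (U n ω)}) atTop (𝓝 0)) :
    TendstoInDistribution (fun (n : ℕ) ω => √(n : ℝ) • (Q n ω - h 0)) atTop (L ∘ Z)
      (fun _ => P) P' := by
  -- Slutsky: it suffices that √n (Q - h 0) differs from L (√n U) by a term tending to zero in
  -- probability.
  refine tendstoInDistribution_of_tendstoInMeasure_sub _ _ (hU.continuous_comp L.continuous) ?_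
    fun n => ((hQ n).sub_const _).const_smul _
  refine tendstoInMeasure_iff_norm.2 fun ε hε => ENNReal.tendsto_nhds_zero.2 fun η hη => ?_
  have hη2 : 0 < η / 2 := ENNReal.half_pos hη.ne'
  obtain ⟨K, hK0, hK⟩ := hU.exists_measure_le_norm_lt hη2
  -- With this slope, ‖√n U‖ < K forces the rescaled remainder to be at most ε/2 < ε.
  have hsmall : ∀ᶠ u in 𝓝 (0 : E), ‖h u - h 0 - L u‖ ≤ ε / (2 * K) * ‖u‖ := by
    simpa using hL.isLittleO.def (c := ε / (2 * K)) (by positivity)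
  obtain ⟨r, hr, hball⟩ := Metric.eventually_nhds_iff.1 hsmall
  have hsqrt : Tendsto (fun n : ℕ => √(n : ℝ)) atTop atTop :=
    Real.tendsto_sqrt_atTop.comp tendsto_natCast_atTop_atTop
  filter_upwards [hK, hsqrt.eventually_ge_atTop (K / r), ENNReal.tendsto_nhds_zero.1 hQU _ hη2]
    with n hn hKn hQn
  calc P {ω | ε ≤ ‖((fun (n : ℕ) ω => √(n : ℝ) • (Q n ω - h 0)) -
        fun (n : ℕ) => L ∘ fun ω => √(n : ℝ) • U n ω) n ω - (0 : ℕ → Ω → F) n ω‖}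
      ≤ P ({ω | K ≤ ‖√(n : ℝ) • U n ω‖} ∪ {ω | Q n ω ≠ h (U n ω)}) := by
        refine measure_mono fun ω hω => ?_
        by_contra hcon
        simp only [Set.mem_union, Set.mem_ofPred_eq, not_or, not_le, not_not] at hcon
        obtain ⟨hlt, heq⟩ := hcon
        simp only [Set.mem_ofPred_eq, Pi.sub_apply, Pi.zero_apply, sub_zero, Function.comp_apply,
          heq, map_smul, ← smul_sub] at hω
        rw [norm_smul, Real.norm_eq_abs, abs_of_nonneg (Real.sqrt_nonneg _)] at hω hlt
        have hUr : ‖U n ω‖ < r := by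
          by_contra! hle
          rw [div_le_iff₀ hr] at hKn
          exact absurd (hKn.trans (mul_le_mul_of_nonneg_left hle (Real.sqrt_nonneg _))) hlt.not_ge
        have hrem := hball (y := U n ω) (by simpa using hUr)
        have : √(n : ℝ) * ‖h (U n ω) - h 0 - L (U n ω)‖ ≤ ε / 2 := by
          calc √(n : ℝ) * ‖h (U n ω) - h 0 - L (U n ω)‖
              ≤ √(n : ℝ) * (ε / (2 * K) * ‖U n ω‖) :=
                mul_le_mul_of_nonneg_left hrem (Real.sqrt_nonneg _)
            _ = ε / (2 * K) * (√(n : ℝ) * ‖U n ω‖) := by ring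
            _ ≤ ε / (2 * K) * K := mul_le_mul_of_nonneg_left hlt.le (by positivity)
            _ = ε / 2 := by field_simp
        linarith
    _ ≤ η / 2 + η / 2 := (measure_union_le _ _).trans (add_le_add hn.le hQn)
    _ = η := ENNReal.add_halves η

end MeasureTheory

/-! ### The Jacobians of ψ and φ -/

namespace Pearson

lemma hasStrictFDerivAt_coord (i : Fin 4) (x : EuclideanSpace ℝ (Fin 4)) :
    HasStrictFDerivAt (fun y : EuclideanSpace ℝ (Fin 4) => y i)
      (EuclideanSpace.proj (𝕜 := ℝ) i : EuclideanSpace ℝ (Fin 4) →L[ℝ] ℝ) x :=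
  (EuclideanSpace.proj (𝕜 := ℝ) i : EuclideanSpace ℝ (Fin 4) →L[ℝ] ℝ).hasStrictFDerivAt

lemma hasStrictFDerivAt_div {E : Type*} [NormedAddCommGroup E] [NormedSpace ℝ E] {a b : E → ℝ}
    {a' b' : E →L[ℝ] ℝ} {x : E} (ha : HasStrictFDerivAt a a' x) (hb : HasStrictFDerivAt b b' x)
    (hx : b x ≠ 0) :
    HasStrictFDerivAt (fun y => a y / b y) ((b x)⁻¹ • a' - (a x / b x ^ 2) • b') x := by
  have hinv := (hasStrictDerivAt_inv hx).comp_hasStrictFDerivAt x hb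
  simp_rw [div_eq_mul_inv]
  refine (ha.mul hinv).congr_fderiv ?_
  ext v
  simp
  ring

lemma hasFDerivAt_psi (μ₂ μ₃ μ₄ : ℝ) :
    HasFDerivAt psi (Matrix.toEuclideanCLM (𝕜 := ℝ) (jPsi μ₂ μ₃)) !₂[0, μ₂, μ₃, μ₄] := by
  have h0 := hasStrictFDerivAt_coord 0 !₂[0, μ₂, μ₃, μ₄]
  have h1 := hasStrictFDerivAt_coord 1 !₂[0, μ₂, μ₃, μ₄]
  have h2 := hasStrictFDerivAt_coord 2 !₂[0, μ₂, μ₃, μ₄]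
  have h3 := hasStrictFDerivAt_coord 3 !₂[0, μ₂, μ₃, μ₄]
  refine (hasStrictFDerivAt_euclidean.2 fun i => ?_).hasFDerivAt
  fin_cases i
  · refine h0.congr_fderiv ?_
    ext v
    simp [jPsi, Matrix.mulVec, dotProduct, Fin.sum_univ_four]
  · refine (h1.sub (h0.pow 2)).congr_fderiv ?_
    ext v
    simp [jPsi, Matrix.mulVec, dotProduct, Fin.sum_univ_four]
  · refine ((h2.sub ((h1.const_mul 3).mul h0)).add ((h0.pow 3).const_mul 2)).congr_fderiv ?_
    ext v
    simp [jPsi, Matrix.mulVec, dotProduct, Fin.sum_univ_four]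
    ring
  · refine (((h3.sub ((h2.const_mul 4).mul h0)).add ((h1.const_mul 6).mul (h0.pow 2))).sub
      ((h0.pow 4).const_mul 3)).congr_fderiv ?_
    ext v
    simp [jPsi, Matrix.mulVec, dotProduct, Fin.sum_univ_four]
    ring

lemma hasStrictFDerivAt_six_mul_theta (m μ₂ μ₃ μ₄ : ℝ) :
    HasStrictFDerivAt (fun y : EuclideanSpace ℝ (Fin 4) => 6 * theta (y 1) (y 2) (y 3))
      (6 • (μ₄ • EuclideanSpace.proj (𝕜 := ℝ) 1 + μ₂ • EuclideanSpace.proj (𝕜 := ℝ) 3 -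
        (2 * μ₃) • EuclideanSpace.proj (𝕜 := ℝ) 2 -
        (3 * μ₂ ^ 2) • EuclideanSpace.proj (𝕜 := ℝ) 1)) !₂[m, μ₂, μ₃, μ₄] := by
  have h1 := hasStrictFDerivAt_coord 1 !₂[m, μ₂, μ₃, μ₄]
  have h2 := hasStrictFDerivAt_coord 2 !₂[m, μ₂, μ₃, μ₄]
  have h3 := hasStrictFDerivAt_coord 3 !₂[m, μ₂, μ₃, μ₄]
  refine (((((h3.mul h1).sub (h2.pow 2)).sub (h1.pow 3))).const_mul 6).congr_fderiv ?_
  ext v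
  simp

lemma hasFDerivAt_phiDiscrete {m μ₂ μ₃ μ₄ : ℝ} (hθ : theta μ₂ μ₃ μ₄ ≠ 0) :
    HasFDerivAt phiDiscrete (Matrix.toEuclideanCLM (𝕜 := ℝ) (jPhiDiscrete μ₂ μ₃ μ₄))
      !₂[m, μ₂, μ₃, μ₄] := by
  have h0 := hasStrictFDerivAt_coord 0 !₂[m, μ₂, μ₃, μ₄]
  have h1 := hasStrictFDerivAt_coord 1 !₂[m, μ₂, μ₃, μ₄]
  have h2 := hasStrictFDerivAt_coord 2 !₂[m, μ₂, μ₃, μ₄]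
  have h3 := hasStrictFDerivAt_coord 3 !₂[m, μ₂, μ₃, μ₄]
  have ht := hasStrictFDerivAt_six_mul_theta m μ₂ μ₃ μ₄
  have ht0 : 6 * theta μ₂ μ₃ μ₄ ≠ 0 := mul_ne_zero (by norm_num) hθ
  refine (hasStrictFDerivAt_euclidean.2 fun i => ?_).hasFDerivAt
  fin_cases i
  · refine h0.congr_fderiv ?_
    ext v
    simp [jPhiDiscrete, Matrix.mulVec, dotProduct, Fin.sum_univ_four]
    field_simp
  · refine (hasStrictFDerivAt_div
      (((((h3.const_mul 2).mul h1).sub ((h2.pow 2).const_mul 3)).sub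
        ((h1.pow 3).const_mul 6)).add (h1.pow 2))
      ht ht0).congr_fderiv ?_
    ext v
    simp [jPhiDiscrete, Matrix.mulVec, dotProduct, Fin.sum_univ_four]
    -- `theta` stays folded while denominators are cleared, so that its nonvanishing can be used;
    -- only then is it expanded for `ring`.
    field_simp
    simp only [theta]
    ring
  · refine (hasStrictFDerivAt_div
      ((((((h3.mul h2).sub ((h3.const_mul 3).mul h1)).add
        ((h2.pow 2).const_mul 3)).add ((h2.const_mul 3).mul (h1.pow 2))).sub (h2.mul h1)).add
        ((h1.pow 3).const_mul 3))
      ht ht0).congr_fderiv ?_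
    ext v
    simp [jPhiDiscrete, Matrix.mulVec, dotProduct, Fin.sum_univ_four]
    field_simp
    simp only [theta]
    ring
  · refine (hasStrictFDerivAt_div
      ((((h3.const_mul 4).mul (h1.pow 2)).sub (((h2.pow 2).const_mul 3).mul h1)).sub (h1.pow 3))
      ht ht0).congr_fderiv ?_
    ext v
    simp [jPhiDiscrete, Matrix.mulVec, dotProduct, Fin.sum_univ_four]
    field_simp
    simp only [theta]
    ring

lemma hasFDerivAt_phiContinuous {m μ₂ μ₃ μ₄ : ℝ} (hθ : theta μ₂ μ₃ μ₄ ≠ 0) :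
    HasFDerivAt phiContinuous (Matrix.toEuclideanCLM (𝕜 := ℝ) (jPhiContinuous μ₂ μ₃ μ₄))
      !₂[m, μ₂, μ₃, μ₄] := by
  have h0 := hasStrictFDerivAt_coord 0 !₂[m, μ₂, μ₃, μ₄]
  have h1 := hasStrictFDerivAt_coord 1 !₂[m, μ₂, μ₃, μ₄]
  have h2 := hasStrictFDerivAt_coord 2 !₂[m, μ₂, μ₃, μ₄]
  have h3 := hasStrictFDerivAt_coord 3 !₂[m, μ₂, μ₃, μ₄]
  have ht := hasStrictFDerivAt_six_mul_theta m μ₂ μ₃ μ₄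
  have ht0 : 6 * theta μ₂ μ₃ μ₄ ≠ 0 := mul_ne_zero (by norm_num) hθ
  refine (hasStrictFDerivAt_euclidean.2 fun i => ?_).hasFDerivAt
  fin_cases i
  · refine h0.congr_fderiv ?_
    ext v
    simp [jPhiContinuous, Matrix.mulVec, dotProduct, Fin.sum_univ_four]
    field_simp
  · refine (hasStrictFDerivAt_div
      ((((h3.const_mul 2).mul h1).sub ((h2.pow 2).const_mul 3)).sub ((h1.pow 3).const_mul 6))
      ht ht0).congr_fderiv ?_
    ext v
    simp [jPhiContinuous, Matrix.mulVec, dotProduct, Fin.sum_univ_four]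
    field_simp
    simp only [theta]
    ring
  · refine (hasStrictFDerivAt_div
      ((h3.mul h2).add ((h2.const_mul 3).mul (h1.pow 2)))
      ht ht0).congr_fderiv ?_
    ext v
    simp [jPhiContinuous, Matrix.mulVec, dotProduct, Fin.sum_univ_four]
    field_simp
    simp only [theta]
    ring
  · refine (hasStrictFDerivAt_div
      (((h3.const_mul 4).mul (h1.pow 2)).sub (((h2.pow 2).const_mul 3).mul h1))
      ht ht0).congr_fderiv ?_
    ext v
    simp [jPhiContinuous, Matrix.mulVec, dotProduct, Fin.sum_univ_four]
    field_simp
    simp only [theta]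
    ring

/-! ### Central moments and positivity of Θ -/

variable {Ω : Type*} [MeasurableSpace Ω] {P : Measure Ω} {X : Ω → ℝ}

lemma memLp_sub_const_of_integrable_pow [IsProbabilityMeasure P] (hX : AEMeasurable X P)
    (h8 : Integrable (fun ω => X ω ^ 8) P) (m : ℝ) : MemLp (fun ω => X ω - m) 8 P := by
  have : MemLp X 8 P := by
    rw [← integrable_norm_rpow_iff hX.aestronglyMeasurable (by norm_num) (by norm_num)]
    have h : (8 : ENNReal).toReal = ((8 : ℕ) : ℝ) := by norm_num
    simp_rw [h, Real.rpow_natCast, ← norm_pow]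
    exact h8.norm
  exact this.sub (memLp_const m)

lemma integrable_pow_of_memLp [IsProbabilityMeasure P] {Y : Ω → ℝ} {N : ℕ}
    (hY : MemLp Y N P) {k : ℕ} (hk : k ≤ N) :
    Integrable (fun ω => Y ω ^ k) P := by
  rcases Nat.eq_zero_or_pos k with rfl | hpos
  · simp
  · have := (hY.mono_exponent (p := (k : ENNReal)) (by exact_mod_cast hk)).integrable_norm_pow
      hpos.ne'
    refine this.mono' (hY.aestronglyMeasurable.pow k) (ae_of_all _ fun ω => ?_)
    simp

lemma centralMoment_eq_integral (k : ℕ) :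
    centralMoment X k P = ∫ ω, (X ω - P[X]) ^ k ∂P := rfl

/-- The linear term drops out because E(X - μ) = 0. Degree 5 matches `integrable_poly_of_memLp`,
which must cover q(x)(x - μ)³. -/
lemma integral_poly_centralMoment [IsProbabilityMeasure P] (hX : MemLp (fun ω => X ω - P[X]) 8 P)
    (a₀ a₁ a₂ a₃ a₄ a₅ : ℝ) :
    ∫ ω, (a₀ + a₁ * (X ω - P[X]) + a₂ * (X ω - P[X]) ^ 2 + a₃ * (X ω - P[X]) ^ 3 +
      a₄ * (X ω - P[X]) ^ 4 + a₅ * (X ω - P[X]) ^ 5) ∂P =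
    a₀ + a₂ * centralMoment X 2 P + a₃ * centralMoment X 3 P + a₄ * centralMoment X 4 P +
      a₅ * centralMoment X 5 P := by
  have hint (k : ℕ) (hk : k ≤ 8) (a : ℝ) : Integrable (fun ω => a * (X ω - P[X]) ^ k) P :=
    (integrable_pow_of_memLp (N := 8) hX hk).const_mul a
  have h1 : Integrable (fun ω => a₁ * (X ω - P[X])) P := by simpa using hint 1 (by norm_num) a₁
  have h0 : Integrable (fun _ : Ω => a₀) P := integrable_const _
  have hc1 : ∫ ω, (X ω - P[X]) ∂P = 0 := by
    simpa [centralMoment_eq_integral] using centralMoment_one (X := X) (μ := P)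
  have h2 := hint 2 (by norm_num) a₂
  have h3 := hint 3 (by norm_num) a₃
  have h4 := hint 4 (by norm_num) a₄
  have h5 := hint 5 (by norm_num) a₅
  rw [integral_add ((((h0.fun_add h1).fun_add h2).fun_add h3).fun_add h4) h5,
    integral_add (((h0.fun_add h1).fun_add h2).fun_add h3) h4,
    integral_add ((h0.fun_add h1).fun_add h2) h3,
    integral_add (h0.fun_add h1) h2, integral_add h0 h1]
  simp only [integral_const_mul, hc1, integral_const, probReal_univ, centralMoment_eq_integral]
  simp

/-- `Θ > 0` unless `X` is almost surely a root of a fixed quadratic polynomial. -/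
lemma theta_centralMoment_pos [IsProbabilityMeasure P] (hX : MemLp (fun ω => X ω - P[X]) 8 P)
    (hdeg : ∀ a b : ℝ, ¬ ∀ᵐ ω ∂P, (X ω - P[X]) ^ 2 = a * (X ω - P[X]) + b) :
    0 < theta (centralMoment X 2 P) (centralMoment X 3 P) (centralMoment X 4 P) := by
  have hint (k : ℕ) (hk : k ≤ 8) : Integrable (fun ω => (X ω - P[X]) ^ k) P :=
    integrable_pow_of_memLp (N := 8) hX hk
  have hpoly := integral_poly_centralMoment hX
  have h2 : 0 < centralMoment X 2 P := by
    rw [centralMoment_eq_integral]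
    refine lt_of_le_of_ne (integral_nonneg fun ω => sq_nonneg _) fun h => hdeg 0 0 ?_
    have := (integral_eq_zero_iff_of_nonneg (fun ω => sq_nonneg (X ω - P[X]))
      (hint 2 (by norm_num))).1 h.symm
    filter_upwards [this] with ω hω
    simpa using hω
  set c₂ := centralMoment X 2 P
  set c₃ := centralMoment X 3 P
  set c₄ := centralMoment X 4 P
  -- The base of the square is the residual of (X - μ)² after projection onto 1 and X - μ; c₃/c₂ is
  -- the regression slope.
  have hexp (ω : Ω) : ((X ω - P[X]) ^ 2 - c₃ / c₂ * (X ω - P[X]) - c₂) ^ 2 =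
      c₂ ^ 2 + 2 * c₃ * (X ω - P[X]) + ((c₃ / c₂) ^ 2 - 2 * c₂) * (X ω - P[X]) ^ 2 +
      (-2 * (c₃ / c₂)) * (X ω - P[X]) ^ 3 + 1 * (X ω - P[X]) ^ 4 + 0 * (X ω - P[X]) ^ 5 := by
    field_simp
    ring
  have hval : ∫ ω, ((X ω - P[X]) ^ 2 - c₃ / c₂ * (X ω - P[X]) - c₂) ^ 2 ∂P =
      theta c₂ c₃ c₄ / c₂ := by
    simp_rw [hexp]
    rw [hpoly, theta]
    field_simp
    ring
  have hpos : 0 < ∫ ω, ((X ω - P[X]) ^ 2 - c₃ / c₂ * (X ω - P[X]) - c₂) ^ 2 ∂P := by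
    refine lt_of_le_of_ne (integral_nonneg fun ω => sq_nonneg _) fun h => hdeg (c₃ / c₂) c₂ ?_
    have hi : Integrable (fun ω => ((X ω - P[X]) ^ 2 - c₃ / c₂ * (X ω - P[X]) - c₂) ^ 2) P := by
      simp_rw [hexp]
      have h1 := hint 1 (by norm_num)
      simp only [pow_one] at h1
      exact (((((integrable_const _).fun_add (h1.const_mul _)).fun_add
        ((hint 2 (by norm_num)).const_mul _)).fun_add ((hint 3 (by norm_num)).const_mul _)).fun_add
        ((hint 4 (by norm_num)).const_mul _)).fun_add ((hint 5 (by norm_num)).const_mul _)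
    have := (integral_eq_zero_iff_of_nonneg (fun ω => sq_nonneg _) hi).1 h.symm
    filter_upwards [this] with ω hω
    have := pow_eq_zero_iff (two_ne_zero) |>.1 hω
    linarith
  rw [hval] at hpos
  exact (div_pos_iff_of_pos_right h2).1 hpos

/-- Vieta: the two roots in the variable x - m add up to a. -/
lemma eq_or_eq_of_quadratic {a b m x y : ℝ} (hx : (x - m) ^ 2 = a * (x - m) + b)
    (hy : (y - m) ^ 2 = a * (y - m) + b) : y = x ∨ y = a + 2 * m - x := by
  have : (y - x) * (y - (a + 2 * m - x)) = 0 := by linear_combination hy - hx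
  rcases mul_eq_zero.1 this with h | h
  · exact Or.inl (sub_eq_zero.1 h)
  · exact Or.inr (sub_eq_zero.1 h)

/-- Every atom would be a root of the quadratic, but there are three atoms and at most two roots. -/
lemma DiscreteForm.not_ae_quadratic [IsProbabilityMeasure P]
    {δ β γ : ℝ} (h : DiscreteForm P X δ β γ) (a b : ℝ) :
    ¬ ∀ᵐ ω ∂P, (X ω - P[X]) ^ 2 = a * (X ω - P[X]) + b := by
  intro hae
  have hroot (j : ℤ) (hj : 0 < pmf P X j) : ((j : ℝ) - P[X]) ^ 2 = a * (j - P[X]) + b := by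
    by_contra hne
    refine hj.ne' ?_
    rw [pmf, measureReal_def, measure_eq_zero_iff_ae_notMem.2, ENNReal.toReal_zero]
    filter_upwards [hae] with ω hω hXj
    have hXj : X ω = j := hXj
    exact hne (hXj ▸ hω)
  obtain ⟨t, ht, ht3⟩ := Set.exists_subset_encard_eq h.three_le_support
  obtain ⟨x, y, z, hxy, hxz, hyz, rfl⟩ := Set.encard_eq_three.1 ht3
  have hx := hroot x (ht (by simp))
  have hy := hroot y (ht (by simp))
  have hz := hroot z (ht (by simp))
  rcases eq_or_eq_of_quadratic hx hy with h1 | h1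
  · exact hxy (by exact_mod_cast h1.symm)
  rcases eq_or_eq_of_quadratic hx hz with h2 | h2
  · exact hxz (by exact_mod_cast h2.symm)
  exact hyz (by exact_mod_cast h1.trans h2.symm)

/-- The root set is finite, hence Lebesgue null, hence null for a law with a density. -/
lemma ContinuousForm.not_ae_quadratic [IsProbabilityMeasure P]
    {f : ℝ → ℝ} {δ β γ : ℝ} (h : ContinuousForm P X f δ β γ)
    (a b : ℝ) : ¬ ∀ᵐ ω ∂P, (X ω - P[X]) ^ 2 = a * (X ω - P[X]) + b := by
  intro hae
  have hX := h.integrable.aemeasurable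
  set s : Set ℝ := {x | (x - P[X]) ^ 2 = a * (x - P[X]) + b} with hs
  have hsm : MeasurableSet s := measurableSet_eq_fun (by fun_prop) (by fun_prop)
  have hfin : s.Finite := by
    rcases s.eq_empty_or_nonempty with he | ⟨x, hx⟩
    · simp [he]
    · exact (Set.toFinite ({x, a + 2 * (∫ ω, X ω ∂P) - x} : Set ℝ)).subset fun y hy =>
        eq_or_eq_of_quadratic (m := P[X]) hx hy
  have hzero : P.map X s = 0 := by
    rw [h.map_eq]
    exact withDensity_absolutelyContinuous _ _ (hfin.measure_zero _)
  rw [Measure.map_apply_of_aemeasurable hX hsm] at hzero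
  obtain ⟨ω, h1, h2⟩ := (hae.and (measure_eq_zero_iff_ae_notMem.1 hzero)).exists
  exact h2 h1

/-! ### Stein identities -/

lemma DiscreteForm.hasSum_mul_pmf {δ β γ : ℝ} (h : DiscreteForm P X δ β γ) {φ : ℝ → ℝ}
    (hφ : Integrable (fun ω => φ (X ω)) P) :
    HasSum (fun j : ℤ => φ j * pmf P X j) (∫ ω, φ (X ω) ∂P) := by
  have hX := h.integrable.aemeasurable
  have hm (j : ℤ) : NullMeasurableSet {ω | X ω = (j : ℝ)} P :=
    hX.nullMeasurableSet_preimage (measurableSet_singleton (j : ℝ))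
  have hd : Pairwise (Function.onFun (AEDisjoint P) fun j : ℤ => {ω | X ω = (j : ℝ)}) := by
    intro i j hij
    refine Disjoint.aedisjoint (Set.disjoint_left.2 fun ω hi hj => hij ?_)
    simp only [Set.mem_ofPred_eq] at hi hj
    exact_mod_cast hi.symm.trans hj
  have hsum := hasSum_integral_iUnion_ae hm hd hφ.integrableOn
  rw [Measure.restrict_eq_self_of_ae_mem] at hsum
  · convert! hsum using 2 with j
    rw [setIntegral_congr_ae₀ (g := fun _ => φ j) (hm j)
      (ae_of_all _ fun ω hω => congrArg φ hω)]
    simp [pmf, mul_comm]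
  · filter_upwards [h.integer_valued] with ω hω
    simpa using hω

/-- Subtracting the identities at j and j - 1 leaves the single summand k = j. -/
lemma DiscreteForm.quadratic_mul_pmf_sub {δ β γ : ℝ} (h : DiscreteForm P X δ β γ) (j : ℤ) :
    quadratic P[X] δ β γ j * pmf P X j -
      quadratic P[X] δ β γ ((j - 1 : ℤ) : ℝ) * pmf P X (j - 1) = (P[X] - j) * pmf P X j := by
  have hrow (i : ℤ) : HasSum ((Set.Iic i).indicator fun k : ℤ => (P[X] - (k : ℝ)) * pmf P X k)
      (quadratic P[X] δ β γ i * pmf P X i) := by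
    have e : HasSum ((fun k : ℤ => (P[X] - (k : ℝ)) * pmf P X k) ∘ ((↑) : Set.Iic i → ℤ))
      (quadratic P[X] δ β γ i * pmf P X i) := h.identity i
    exact hasSum_subtype_iff_indicator.1 e
  have hsingle (k : ℤ) (hk : k ≠ j) :
      (Set.Iic j).indicator (fun k : ℤ => (P[X] - (k : ℝ)) * pmf P X k) k -
        (Set.Iic (j - 1)).indicator (fun k : ℤ => (P[X] - (k : ℝ)) * pmf P X k) k = 0 := by
    rcases lt_or_gt_of_ne hk with hlt | hgt
    · simp [Set.indicator, hlt.le, Int.le_sub_one_iff.2 hlt]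
    · simp [Set.indicator, hgt.not_ge, (show ¬ k ≤ j - 1 by omega)]
  rw [((hrow j).sub (hrow (j - 1))).unique (hasSum_single j hsingle)]
  simp

/-- The discrete Stein identity. -/
lemma DiscreteForm.integral_mul_eq {δ β γ : ℝ} (h : DiscreteForm P X δ β γ) {g : ℝ → ℝ}
    (h1 : Integrable (fun ω => (X ω - P[X]) * g (X ω)) P)
    (h2 : Integrable (fun ω => quadratic P[X] δ β γ (X ω) * g (X ω)) P)
    (h3 : Integrable (fun ω => quadratic P[X] δ β γ (X ω) * g (X ω + 1)) P) :
    ∫ ω, (X ω - P[X]) * g (X ω) ∂P =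
      ∫ ω, quadratic P[X] δ β γ (X ω) * (g (X ω + 1) - g (X ω)) ∂P := by
  have s1 := h.hasSum_mul_pmf (φ := fun x => (x - P[X]) * g x) h1
  have s2 := h.hasSum_mul_pmf (φ := fun x => quadratic P[X] δ β γ x * g x) h2
  have s3 := h.hasSum_mul_pmf (φ := fun x => quadratic P[X] δ β γ x * g (x + 1)) h3
  -- Summation by parts: the index shift j ↦ j - 1 puts g(j) into both sums, so the one-step
  -- recurrence applies termwise.
  rw [← (Equiv.subRight (1 : ℤ)).hasSum_iff] at s3
  have hint : ∫ ω, quadratic P[X] δ β γ (X ω) * (g (X ω + 1) - g (X ω)) ∂P =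
      ∫ ω, quadratic P[X] δ β γ (X ω) * g (X ω + 1) ∂P -
        ∫ ω, quadratic P[X] δ β γ (X ω) * g (X ω) ∂P := by
    rw [← integral_sub h3 h2]
    simp_rw [mul_sub]
  rw [hint]
  refine s1.unique (HasSum.congr_fun (s3.sub s2) fun j => ?_)
  have hj := h.quadratic_mul_pmf_sub j
  simp only [Function.comp_apply, Equiv.subRight_apply, Int.cast_sub, Int.cast_one,
    sub_add_cancel] at hj ⊢
  linear_combination g j * hj

lemma ContinuousForm.integral_comp {f : ℝ → ℝ} {δ β γ : ℝ} (h : ContinuousForm P X f δ β γ)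
    {φ : ℝ → ℝ} (hφ : Measurable φ) : ∫ ω, φ (X ω) ∂P = ∫ x, φ x * f x := by
  rw [← integral_map h.integrable.aemeasurable hφ.aestronglyMeasurable, h.map_eq,
    integral_withDensity_eq_integral_toReal_smul h.measurable_density.ennreal_ofReal
      (ae_of_all _ fun _ => ENNReal.ofReal_lt_top)]
  simp [ENNReal.toReal_ofReal (h.density_nonneg _), mul_comm]

lemma ContinuousForm.integrable_mul {f : ℝ → ℝ} {δ β γ : ℝ} (h : ContinuousForm P X f δ β γ)
    {φ : ℝ → ℝ} (hφ : Measurable φ) (hint : Integrable (fun ω => φ (X ω)) P) :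
    Integrable (fun x => φ x * f x) := by
  have : Integrable φ (P.map X) :=
    (integrable_map_measure hφ.aestronglyMeasurable h.integrable.aemeasurable).2 hint
  rw [h.map_eq, integrable_withDensity_iff h.measurable_density.ennreal_ofReal
    (ae_of_all _ fun _ => ENNReal.ofReal_lt_top)] at this
  simpa [ENNReal.toReal_ofReal (h.density_nonneg _)] using this

/-- The continuous Stein identity. -/
lemma ContinuousForm.integral_mul_eq [IsProbabilityMeasure P]
    {f : ℝ → ℝ} {δ β γ : ℝ} (h : ContinuousForm P X f δ β γ)
    {g : ℝ → ℝ} (hg : ContDiff ℝ 1 g)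
    (h1 : Integrable (fun ω => (X ω - P[X]) * g (X ω)) P)
    (h2 : Integrable (fun ω => quadratic P[X] δ β γ (X ω) * g (X ω)) P)
    (h3 : Integrable (fun ω => quadratic P[X] δ β γ (X ω) * deriv g (X ω)) P) :
    ∫ ω, (X ω - P[X]) * g (X ω) ∂P = ∫ ω, quadratic P[X] δ β γ (X ω) * deriv g (X ω) ∂P := by
  have hgm : Measurable g := hg.continuous.measurable
  have hdm : Measurable (deriv g) := measurable_deriv g
  have hqm : Measurable (quadratic P[X] δ β γ) := by unfold quadratic; fun_prop
  have hid : Integrable (fun x : ℝ => (P[X] - x) * f x) :=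
    h.integrable_mul (φ := fun x => P[X] - x) (by fun_prop)
      ((integrable_const _).sub h.integrable)
  set F : ℝ → ℝ := fun x => quadratic P[X] δ β γ x * f x with hF
  have hFint (a x : ℝ) : F x = F a + ∫ t in a..x, (P[X] - t) * f t := by
    rw [← intervalIntegral.integral_Iic_sub_Iic hid.integrableOn hid.integrableOn, h.identity,
      h.identity]
    ring
  -- No regularity of f is assumed, but F = q f is an indefinite integral of (μ - t) f(t), hence
  -- absolutely continuous; that suffices for integration by parts.
  have hFac (a b : ℝ) : AbsolutelyContinuousOnInterval F a b := by
    rw [funext (hFint a)]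
    exact (AbsolutelyContinuousOnInterval.fun_add
      (contDiffOn_const.absolutelyContinuousOnInterval)
      (hid.intervalIntegrable.absolutelyContinuousOnInterval_intervalIntegral (by simp)))
  have hFd : ∀ᵐ x, deriv F x = (P[X] - x) * f x := by
    filter_upwards [LocallyIntegrable.ae_hasDerivAt_integral hid.locallyIntegrable] with x hx
    rw [funext (hFint 0)]
    exact ((hx 0).const_add _).deriv
  have hgac (a b : ℝ) : AbsolutelyContinuousOnInterval g a b :=
    hg.contDiffOn.absolutelyContinuousOnInterval
  have i1 : Integrable fun x => (x - P[X]) * g x * f x :=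
    h.integrable_mul (φ := fun x => (x - P[X]) * g x) (by fun_prop) h1
  have i2 : Integrable fun x => quadratic P[X] δ β γ x * g x * f x :=
    h.integrable_mul (φ := fun x => quadratic P[X] δ β γ x * g x) (by fun_prop) h2
  have i3 : Integrable fun x => quadratic P[X] δ β γ x * deriv g x * f x :=
    h.integrable_mul (φ := fun x => quadratic P[X] δ β γ x * deriv g x) (by fun_prop) h3
  have hparts (a b : ℝ) : ∫ x in a..b, (quadratic P[X] δ β γ x * deriv g x * f x -
      (x - P[X]) * g x * f x) = F b * g b - F a * g a := by
    rw [← (hFac a b).integral_deriv_mul_eq_sub (hgac a b)]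
    refine intervalIntegral.integral_congr_ae ?_
    filter_upwards [hFd] with x hx _
    rw [hx]
    simp only [hF]
    ring
  have hi2' : Integrable fun x => F x * g x := by
    refine i2.congr (ae_of_all _ fun x => ?_)
    simp only [hF]
    ring
  -- The boundary term has a limit since the integrand in `hparts` is integrable. F g is itself
  -- integrable and a half-line has infinite measure, so the limit is 0.
  have htop : Tendsto (fun x => F x * g x) atTop (𝓝 0) := by
    have hl : Tendsto (fun b => F 0 * g 0 + ∫ x in (0 : ℝ)..b,
        (quadratic P[X] δ β γ x * deriv g x * f x - (x - P[X]) * g x * f x)) atTop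
        (𝓝 (F 0 * g 0 + ∫ x in Set.Ioi (0 : ℝ),
          (quadratic P[X] δ β γ x * deriv g x * f x - (x - P[X]) * g x * f x))) :=
      (intervalIntegral_tendsto_integral_Ioi 0 (i3.sub i1).integrableOn tendsto_id).const_add _
    simp only [hparts, add_sub_cancel] at hl
    rwa [IntegrableAtFilter.eq_zero_of_tendsto ⟨Set.univ, univ_mem, hi2'.integrableOn⟩
      (fun s hs => ?_) hl] at hl
    obtain ⟨c, hc⟩ := mem_atTop_sets.1 hs
    exact measure_mono_top (show Set.Ici c ⊆ s from hc) Real.volume_Ici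
  have hbot : Tendsto (fun x => F x * g x) atBot (𝓝 0) := by
    have hl : Tendsto (fun a => F 0 * g 0 - ∫ x in a..(0 : ℝ),
        (quadratic P[X] δ β γ x * deriv g x * f x - (x - P[X]) * g x * f x)) atBot
        (𝓝 (F 0 * g 0 - ∫ x in Set.Iic (0 : ℝ),
          (quadratic P[X] δ β γ x * deriv g x * f x - (x - P[X]) * g x * f x))) :=
      (intervalIntegral_tendsto_integral_Iic 0 (i3.sub i1).integrableOn tendsto_id).const_sub _
    simp only [hparts, sub_sub_cancel] at hl
    rwa [IntegrableAtFilter.eq_zero_of_tendsto ⟨Set.univ, univ_mem, hi2'.integrableOn⟩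
      (fun s hs => ?_) hl] at hl
    obtain ⟨c, hc⟩ := mem_atBot_sets.1 hs
    exact measure_mono_top (show Set.Iic c ⊆ s from hc) Real.volume_Iic
  have hlim := intervalIntegral_tendsto_integral (i3.sub i1) tendsto_neg_atTop_atBot tendsto_id
  have hzero : Tendsto (fun x : ℝ => F x * g x - F (-x) * g (-x)) atTop (𝓝 0) := by
    simpa using htop.sub (hbot.comp tendsto_neg_atTop_atBot)
  have heq : ∫ x, (quadratic P[X] δ β γ x * deriv g x * f x - (x - P[X]) * g x * f x) = 0 :=
    tendsto_nhds_unique (hlim.congr fun x => hparts _ _) hzero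
  rw [integral_sub i3 i1] at heq
  rw [h.integral_comp (φ := fun x => (x - P[X]) * g x) (by fun_prop),
    h.integral_comp (φ := fun x => quadratic P[X] δ β γ x * deriv g x) (by fun_prop)]
  linarith

/-! ### Recovering δ, β, γ from the moments -/

lemma phiContinuous_eq_of_moments {m c₂ c₃ c₄ δ β γ : ℝ} (hθ : theta c₂ c₃ c₄ ≠ 0)
    (h₁ : c₂ = δ * c₂ + γ) (h₂ : c₃ = 2 * δ * c₃ + 2 * β * c₂)
    (h₃ : c₄ = 3 * (δ * c₄ + β * c₃ + γ * c₂)) :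
    phiContinuous !₂[m, c₂, c₃, c₄] = !₂[m, δ, β, γ] := by
  have h6 : 6 * theta c₂ c₃ c₄ ≠ 0 := mul_ne_zero (by norm_num) hθ
  ext i
  fin_cases i
  · simp [phiContinuous]
  · refine (div_eq_iff h6).2 ?_
    change _ = δ * _
    simp only [theta, Matrix.cons_val]
    -- Cramer's rule: the multipliers are the negated cofactors of the δ column, the determinant
    -- being -6Θ. The β and γ columns are treated alike.
    linear_combination -(6 * c₂ ^ 2) * h₁ - 3 * c₃ * h₂ + 2 * c₂ * h₃
  · refine (div_eq_iff h6).2 ?_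
    change _ = β * _
    simp only [theta, Matrix.cons_val]
    linear_combination 6 * c₂ * c₃ * h₁ - (3 * c₂ ^ 2 - 3 * c₄) * h₂ - 2 * c₃ * h₃
  · refine (div_eq_iff h6).2 ?_
    change _ = γ * _
    simp only [theta, Matrix.cons_val]
    linear_combination (-(6 * c₃ ^ 2) + 6 * c₂ * c₄) * h₁ + 3 * c₂ * c₃ * h₂ - 2 * c₂ ^ 2 * h₃

lemma phiDiscrete_eq_of_moments {m c₂ c₃ c₄ δ β γ : ℝ} (hθ : theta c₂ c₃ c₄ ≠ 0)
    (h₁ : c₂ = δ * c₂ + γ) (h₂ : c₃ = 2 * δ * c₃ + 2 * β * c₂ + (δ * c₂ + γ))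
    (h₃ : c₄ = 3 * (δ * c₄ + β * c₃ + γ * c₂) + 3 * (δ * c₃ + β * c₂) + (δ * c₂ + γ)) :
    phiDiscrete !₂[m, c₂, c₃, c₄] = !₂[m, δ, β, γ] := by
  have h6 : 6 * theta c₂ c₃ c₄ ≠ 0 := mul_ne_zero (by norm_num) hθ
  -- Eliminating the lower-order difference terms gives the matrix of the continuous case with new
  -- left-hand sides, so the same cofactors solve it.
  have h₂' : c₃ - c₂ = 2 * δ * c₃ + 2 * β * c₂ := by linear_combination h₂ - h₁
  have h₃' : c₄ - 3 / 2 * c₃ + c₂ / 2 = 3 * (δ * c₄ + β * c₃ + γ * c₂) := by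
    linear_combination h₃ - 3 / 2 * h₂ + h₁ / 2
  ext i
  fin_cases i
  · simp [phiDiscrete]
  · refine (div_eq_iff h6).2 ?_
    change _ = δ * _
    simp only [theta, Matrix.cons_val]
    linear_combination -(6 * c₂ ^ 2) * h₁ - 3 * c₃ * h₂' + 2 * c₂ * h₃'
  · refine (div_eq_iff h6).2 ?_
    change _ = β * _
    simp only [theta, Matrix.cons_val]
    linear_combination 6 * c₂ * c₃ * h₁ - (3 * c₂ ^ 2 - 3 * c₄) * h₂' - 2 * c₃ * h₃'
  · refine (div_eq_iff h6).2 ?_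
    change _ = γ * _
    simp only [theta, Matrix.cons_val]
    linear_combination (-(6 * c₃ ^ 2) + 6 * c₂ * c₄) * h₁ + 3 * c₂ * c₃ * h₂' - 2 * c₂ ^ 2 * h₃'

section Moments

variable {Ω : Type*} [MeasurableSpace Ω] {P : Measure Ω} {X : Ω → ℝ}

lemma integrable_poly_of_memLp [IsProbabilityMeasure P] {Y : Ω → ℝ} (hY : MemLp Y 8 P)
    (a₀ a₁ a₂ a₃ a₄ a₅ : ℝ) :
    Integrable (fun ω => a₀ + a₁ * Y ω + a₂ * Y ω ^ 2 + a₃ * Y ω ^ 3 + a₄ * Y ω ^ 4 +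
      a₅ * Y ω ^ 5) P := by
  have hint (k : ℕ) (hk : k ≤ 8) (a : ℝ) : Integrable (fun ω => a * Y ω ^ k) P :=
    (integrable_pow_of_memLp (N := 8) hY hk).const_mul a
  have h1 : Integrable (fun ω => a₁ * Y ω) P := by simpa using hint 1 (by norm_num) a₁
  exact ((((((integrable_const a₀).fun_add h1).fun_add (hint 2 (by norm_num) a₂)).fun_add
    (hint 3 (by norm_num) a₃)).fun_add (hint 4 (by norm_num) a₄)).fun_add
    (hint 5 (by norm_num) a₅))

lemma ContinuousForm.phiContinuous_eq [IsProbabilityMeasure P] {f : ℝ → ℝ} {δ β γ : ℝ}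
    (h : ContinuousForm P X f δ β γ) (hX : MemLp (fun ω => X ω - P[X]) 8 P)
    (hθ : theta (centralMoment X 2 P) (centralMoment X 3 P) (centralMoment X 4 P) ≠ 0) :
    phiContinuous !₂[P[X], centralMoment X 2 P, centralMoment X 3 P, centralMoment X 4 P] =
      !₂[P[X], δ, β, γ] := by
  have hint := integrable_poly_of_memLp hX
  have hpoly := integral_poly_centralMoment hX
  have hderiv (k : ℕ) (x : ℝ) :
      deriv (fun x => (x - P[X]) ^ (k + 1)) x = (k + 1) * (x - P[X]) ^ k := by
    simp
  -- The coefficients a, b, d expand (x - μ) g, q g' and q g in powers of x - μ, for g = (x -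
  -- μ)^(k+1); d serves integrability only.
  have key (k : ℕ) (a₀ a₁ a₂ a₃ a₄ a₅ b₀ b₁ b₂ b₃ b₄ b₅ d₀ d₁ d₂ d₃ d₄ d₅ : ℝ)
      (ha : ∀ y : ℝ, y * y ^ (k + 1) =
        a₀ + a₁ * y + a₂ * y ^ 2 + a₃ * y ^ 3 + a₄ * y ^ 4 + a₅ * y ^ 5)
      (hb : ∀ y : ℝ, (δ * y ^ 2 + β * y + γ) * ((k + 1) * y ^ k) =
        b₀ + b₁ * y + b₂ * y ^ 2 + b₃ * y ^ 3 + b₄ * y ^ 4 + b₅ * y ^ 5)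
      (hd : ∀ y : ℝ, (δ * y ^ 2 + β * y + γ) * y ^ (k + 1) =
        d₀ + d₁ * y + d₂ * y ^ 2 + d₃ * y ^ 3 + d₄ * y ^ 4 + d₅ * y ^ 5) :
      a₀ + a₂ * centralMoment X 2 P + a₃ * centralMoment X 3 P + a₄ * centralMoment X 4 P +
        a₅ * centralMoment X 5 P =
      b₀ + b₂ * centralMoment X 2 P + b₃ * centralMoment X 3 P + b₄ * centralMoment X 4 P +
        b₅ * centralMoment X 5 P := by
    have := h.integral_mul_eq (g := fun x => (x - P[X]) ^ (k + 1)) (by fun_prop)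
      (by simp_rw [ha]; exact hint ..) (by simp_rw [quadratic, hd]; exact hint ..)
      (by simp_rw [hderiv, quadratic, hb]; exact hint ..)
    simp_rw [hderiv, quadratic, ha, hb] at this
    rwa [hpoly, hpoly] at this
  have e₁ := key 0 0 0 1 0 0 0 γ β δ 0 0 0 0 γ β δ 0 0
    (fun y => by push_cast; ring) (fun y => by push_cast; ring) (fun y => by push_cast; ring)
  have e₂ := key 1 0 0 0 1 0 0 0 (2 * γ) (2 * β) (2 * δ) 0 0 0 0 γ β δ 0
    (fun y => by push_cast; ring) (fun y => by push_cast; ring) (fun y => by push_cast; ring)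
  have e₃ := key 2 0 0 0 0 1 0 0 0 (3 * γ) (3 * β) (3 * δ) 0 0 0 0 γ β δ
    (fun y => by push_cast; ring) (fun y => by push_cast; ring) (fun y => by push_cast; ring)
  exact phiContinuous_eq_of_moments hθ (by linarith) (by linarith) (by linarith)

lemma DiscreteForm.phiDiscrete_eq [IsProbabilityMeasure P] {δ β γ : ℝ}
    (h : DiscreteForm P X δ β γ) (hX : MemLp (fun ω => X ω - P[X]) 8 P)
    (hθ : theta (centralMoment X 2 P) (centralMoment X 3 P) (centralMoment X 4 P) ≠ 0) :
    phiDiscrete !₂[P[X], centralMoment X 2 P, centralMoment X 3 P, centralMoment X 4 P] =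
      !₂[P[X], δ, β, γ] := by
  have hint := integrable_poly_of_memLp hX
  have hpoly := integral_poly_centralMoment hX
  have key (k : ℕ) (a₀ a₁ a₂ a₃ a₄ a₅ b₀ b₁ b₂ b₃ b₄ b₅ d₀ d₁ d₂ d₃ d₄ d₅ : ℝ)
      (ha : ∀ y : ℝ, y * y ^ (k + 1) =
        a₀ + a₁ * y + a₂ * y ^ 2 + a₃ * y ^ 3 + a₄ * y ^ 4 + a₅ * y ^ 5)
      (hb : ∀ y : ℝ, (δ * y ^ 2 + β * y + γ) * ((y + 1) ^ (k + 1) - y ^ (k + 1)) =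
        b₀ + b₁ * y + b₂ * y ^ 2 + b₃ * y ^ 3 + b₄ * y ^ 4 + b₅ * y ^ 5)
      (hd : ∀ y : ℝ, (δ * y ^ 2 + β * y + γ) * y ^ (k + 1) =
        d₀ + d₁ * y + d₂ * y ^ 2 + d₃ * y ^ 3 + d₄ * y ^ 4 + d₅ * y ^ 5) :
      a₀ + a₂ * centralMoment X 2 P + a₃ * centralMoment X 3 P + a₄ * centralMoment X 4 P +
        a₅ * centralMoment X 5 P =
      b₀ + b₂ * centralMoment X 2 P + b₃ * centralMoment X 3 P + b₄ * centralMoment X 4 P +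
        b₅ * centralMoment X 5 P := by
    have hshift (x : ℝ) : x + 1 - P[X] = x - P[X] + 1 := by ring
    -- The shifted product q(x) g(x + 1) is q g + q Δg; this gives its integrability.
    have hs (y : ℝ) : (δ * y ^ 2 + β * y + γ) * (y + 1) ^ (k + 1) =
        (d₀ + d₁ * y + d₂ * y ^ 2 + d₃ * y ^ 3 + d₄ * y ^ 4 + d₅ * y ^ 5) +
        (b₀ + b₁ * y + b₂ * y ^ 2 + b₃ * y ^ 3 + b₄ * y ^ 4 + b₅ * y ^ 5) := by
      rw [← hb, ← hd]
      ring
    have := h.integral_mul_eq (g := fun x => (x - P[X]) ^ (k + 1))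
      (by simp_rw [ha]; exact hint ..) (by simp_rw [quadratic, hd]; exact hint ..)
      (by simp_rw [hshift, quadratic, hs]; exact (hint ..).fun_add (hint ..))
    simp_rw [hshift, quadratic, ha, hb] at this
    rwa [hpoly, hpoly] at this
  have e₁ := key 0 0 0 1 0 0 0 γ β δ 0 0 0 0 γ β δ 0 0
    (fun y => by ring) (fun y => by ring) (fun y => by ring)
  have e₂ := key 1 0 0 0 1 0 0 γ (2 * γ + β) (2 * β + δ) (2 * δ) 0 0 0 0 γ β δ 0
    (fun y => by ring) (fun y => by ring) (fun y => by ring)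
  have e₃ := key 2 0 0 0 0 1 0 γ (3 * γ + β) (3 * γ + 3 * β + δ) (3 * β + 3 * δ) (3 * δ) 0
    0 0 0 γ β δ (fun y => by ring) (fun y => by ring) (fun y => by ring)
  exact phiDiscrete_eq_of_moments hθ (by linarith) (by linarith) (by linarith)

end Moments

/-! ### Algebra of the sample moments -/

section Sample

variable {Ω : Type*} {S : ℕ → Ω → ℝ} {n : ℕ} {ω : Ω}

/-- The vector of the powers `(x - m) ^ k`, `1 ≤ k ≤ 4`, centred by `c k`. -/
def centeredPowers (m : ℝ) (c : ℕ → ℝ) (x : ℝ) : EuclideanSpace ℝ (Fin 4) :=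
  WithLp.toLp 2 fun i => (x - m) ^ ((i : ℕ) + 1) - c ((i : ℕ) + 1)

lemma measurable_centeredPowers (m : ℝ) (c : ℕ → ℝ) : Measurable (centeredPowers m c) := by
  unfold centeredPowers
  fun_prop

/-- Sample central moments are translation invariant, so they may be computed from S - m; binomial
expansion about its average gives ψ. The added vector undoes the centring by c, and m is restored in
the first coordinate. -/
lemma sampleVector_eq_psi (hn : n ≠ 0) (m : ℝ) {c : ℕ → ℝ} (hc : c 1 = 0) :
    sampleVector S n ω = psi ((n : ℝ)⁻¹ • ∑ k ∈ Finset.range n, centeredPowers m c (S k ω) +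
      !₂[0, c 2, c 3, c 4]) + !₂[m, 0, 0, 0] := by
  have hn' : (n : ℝ) ≠ 0 := by exact_mod_cast hn
  set s : ℕ → ℝ := fun j => (n : ℝ)⁻¹ * ∑ k ∈ Finset.range n, (S k ω - m) ^ j with hs
  have hsum (j : ℕ) : ∑ k ∈ Finset.range n, (S k ω - m) ^ j = n * s j := by
    simp only [hs]
    field_simp
  have hsum1 : ∑ k ∈ Finset.range n, (S k ω - m) = n * s 1 := by simpa using hsum 1
  have hmean : sampleMean S n ω = s 1 + m := by
    have : ∑ k ∈ Finset.range n, S k ω = n * s 1 + n * m := by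
      rw [← hsum1]
      simp [Finset.sum_sub_distrib]
    rw [sampleMean, this]
    field_simp
  have hcentral (j : ℕ) : sampleCentralMoment S j n ω =
      (∑ k ∈ Finset.range n, ((S k ω - m) - s 1) ^ j) / n := by
    simp only [sampleCentralMoment, hmean, sub_add_eq_sub_sub_swap]
  have hvec : (n : ℝ)⁻¹ • ∑ k ∈ Finset.range n, centeredPowers m c (S k ω) +
      !₂[0, c 2, c 3, c 4] = !₂[s 1, s 2, s 3, s 4] := by
    ext i
    fin_cases i <;>
    · simp [centeredPowers, hc, Finset.sum_sub_distrib, hs]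
      try field_simp
      try ring
  rw [hvec]
  ext i
  fin_cases i
  · simp [sampleVector, psi, hmean]
  · have (x : ℝ) : (x - s 1) ^ 2 = x ^ 2 - 2 * s 1 * x + s 1 ^ 2 := by ring
    simp only [sampleVector, psi, hcentral, this, Finset.sum_add_distrib, Finset.sum_sub_distrib,
      ← Finset.mul_sum, hsum, hsum1, Finset.sum_const, Finset.card_range]
    simp
    field_simp
    ring
  · have (x : ℝ) : (x - s 1) ^ 3 =
        x ^ 3 - 3 * s 1 * x ^ 2 + 3 * s 1 ^ 2 * x - s 1 ^ 3 := by ring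
    simp only [sampleVector, psi, hcentral, this, Finset.sum_add_distrib, Finset.sum_sub_distrib,
      ← Finset.mul_sum, hsum, hsum1, Finset.sum_const, Finset.card_range]
    simp
    field_simp
    ring
  · have (x : ℝ) : (x - s 1) ^ 4 =
        x ^ 4 - 4 * s 1 * x ^ 3 + 6 * s 1 ^ 2 * x ^ 2 - 4 * s 1 ^ 3 * x + s 1 ^ 4 := by ring
    simp only [sampleVector, psi, hcentral, this, Finset.sum_add_distrib, Finset.sum_sub_distrib,
      ← Finset.mul_sum, hsum, hsum1, Finset.sum_const, Finset.card_range]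
    simp
    field_simp
    ring

lemma exists_quadratic_of_not_threeDistinct (h : ¬ ThreeDistinct S n ω) (m : ℝ) :
    ∃ a b : ℝ, ∀ k < n, (S k ω - m) ^ 2 = a * (S k ω - m) + b := by
  have hfin : ((fun i => S i ω) '' Set.Iio n).Finite := (Set.finite_Iio n).image _
  have hpair : ∃ u v : ℝ, (fun i => S i ω) '' Set.Iio n ⊆ {u, v} := by
    rw [ThreeDistinct, not_le] at h
    interval_cases hcard : ((fun i => S i ω) '' Set.Iio n).ncard
    · exact ⟨0, 0, by simp [(Set.ncard_eq_zero hfin).1 hcard]⟩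
    · obtain ⟨u, hu⟩ := Set.ncard_eq_one.1 hcard
      exact ⟨u, u, by simp [hu]⟩
    · obtain ⟨u, v, -, huv⟩ := Set.ncard_eq_two.1 hcard
      exact ⟨u, v, huv.subset⟩
  obtain ⟨u, v, huv⟩ := hpair
  -- These are the coefficients of (x - u)(x - v) = 0 rewritten in x - m.
  refine ⟨u + v - 2 * m, -((u - m) * (v - m)), fun k hk => ?_⟩
  rcases huv ⟨k, hk, rfl⟩ with h | h
  · simp only at h
    rw [h]
    ring
  · simp only [Set.mem_singleton_iff] at h
    rw [h]
    ring

/-- Two values satisfy one quadratic relation, which yields a recurrence for the sample moments: m₂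
= b, m₃ = a m₂, m₄ = a m₃ + b m₂. Used contrapositively: Θ̂ ≠ 0 forces three distinct values. -/
lemma theta_sample_eq_zero (hn : n ≠ 0) (h : ¬ ThreeDistinct S n ω) :
    theta (sampleCentralMoment S 2 n ω) (sampleCentralMoment S 3 n ω)
      (sampleCentralMoment S 4 n ω) = 0 := by
  have hn' : (n : ℝ) ≠ 0 := by exact_mod_cast hn
  obtain ⟨a, b, hab⟩ := exists_quadratic_of_not_threeDistinct h (sampleMean S n ω)
  have h1 : ∑ k ∈ Finset.range n, (S k ω - sampleMean S n ω) = 0 := by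
    rw [Finset.sum_sub_distrib, sampleMean]
    simp only [Finset.sum_const, Finset.card_range, nsmul_eq_mul]
    field_simp
    ring
  have hrec (j : ℕ) : ∑ k ∈ Finset.range n, (S k ω - sampleMean S n ω) ^ (j + 2) =
      a * ∑ k ∈ Finset.range n, (S k ω - sampleMean S n ω) ^ (j + 1) +
        b * ∑ k ∈ Finset.range n, (S k ω - sampleMean S n ω) ^ j := by
    rw [Finset.mul_sum, Finset.mul_sum, ← Finset.sum_add_distrib]
    refine Finset.sum_congr rfl fun k hk => ?_
    rw [pow_add, hab k (Finset.mem_range.1 hk)]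
    ring
  have h2 : sampleCentralMoment S 2 n ω = b := by
    rw [sampleCentralMoment, hrec 0]
    simp [h1]
    field_simp
  have h3 : sampleCentralMoment S 3 n ω = a * sampleCentralMoment S 2 n ω := by
    rw [sampleCentralMoment, hrec 1, sampleCentralMoment]
    simp [h1, mul_div_assoc]
  have h4 : sampleCentralMoment S 4 n ω =
      a * sampleCentralMoment S 3 n ω + b * sampleCentralMoment S 2 n ω := by
    rw [sampleCentralMoment, hrec 2, sampleCentralMoment, sampleCentralMoment]
    ring
  rw [theta, h4, h3, h2]
  ring

end Sample

/-! ### Asymptotic normality of the estimator -/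

section Asymptotics

variable {Ω Ω' : Type*} [MeasurableSpace Ω] [MeasurableSpace Ω'] {P : Measure Ω}
  [IsProbabilityMeasure P] {P' : Measure Ω'} [IsProbabilityMeasure P'] {X : Ω' → ℝ}
  {S : ℕ → Ω → ℝ}

lemma integral_centeredPowers_mul (hX : MemLp (fun ω => X ω - P'[X]) 8 P') (i j : Fin 4) :
    ∫ ω, centeredPowers P'[X] (centralMoment X · P') (X ω) i *
      centeredPowers P'[X] (centralMoment X · P') (X ω) j ∂P' =
    sigma (centralMoment X · P') i j := by
  have hint (k : ℕ) (hk : k ≤ 8) : Integrable (fun ω => (X ω - P'[X]) ^ k) P' :=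
    integrable_pow_of_memLp (N := 8) hX hk
  set a : ℕ := (i : ℕ) + 1 with ha
  set b : ℕ := (j : ℕ) + 1 with hb
  have hexp (ω : Ω') : centeredPowers P'[X] (centralMoment X · P') (X ω) i *
      centeredPowers P'[X] (centralMoment X · P') (X ω) j =
      (X ω - P'[X]) ^ (a + b) - centralMoment X b P' * (X ω - P'[X]) ^ a -
        centralMoment X a P' * (X ω - P'[X]) ^ b + centralMoment X a P' * centralMoment X b P' := by
    simp only [centeredPowers, ← ha, ← hb]
    ring
  have hab := hint (a + b) (by omega)
  have hia := (hint a (by omega)).const_mul (centralMoment X b P')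
  have hib := (hint b (by omega)).const_mul (centralMoment X a P')
  have hab' := hab.sub hia
  have hab'' := hab'.sub hib
  simp only [Pi.sub_def] at hab' hab''
  simp_rw [hexp]
  rw [integral_add hab'' (integrable_const _), integral_sub hab' hib,
    integral_sub hab hia, integral_const_mul, integral_const_mul]
  simp only [← centralMoment_eq_integral, sigma, Matrix.of_apply, ← ha, ← hb]
  simp
  ring

lemma memLp_centeredPowers (hX : MemLp (fun ω => X ω - P'[X]) 8 P') (i : Fin 4) :
    MemLp (fun ω => centeredPowers P'[X] (centralMoment X · P') (X ω) i) 2 P' := by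
  simp only [centeredPowers]
  refine MemLp.sub ?_ (memLp_const _)
  refine (memLp_two_iff_integrable_sq (hX.aestronglyMeasurable.pow _)).2 ?_
  refine (integrable_pow_of_memLp (N := 8) hX (k := ((i : ℕ) + 1) * 2) (by omega)).congr
    (ae_of_all _ fun ω => ?_)
  simp [pow_mul]

lemma integral_centeredPowers (hX : MemLp (fun ω => X ω - P'[X]) 8 P') (i : Fin 4) :
    ∫ ω, centeredPowers P'[X] (centralMoment X · P') (X ω) i ∂P' = 0 := by
  simp only [centeredPowers]
  rw [integral_sub (integrable_pow_of_memLp (N := 8) hX (by omega)) (integrable_const _),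
    ← centralMoment_eq_integral]
  simp

/-- Central limit theorem for the first four centred powers. -/
lemma tendstoInDistribution_centeredPowers (hindep : iIndepFun S P)
    (hident : ∀ i, IdentDistrib (S i) X P P') (hX : MemLp (fun ω => X ω - P'[X]) 8 P') :
    TendstoInDistribution (fun (n : ℕ) ω => √(n : ℝ) • ((n : ℝ)⁻¹ •
        ∑ k ∈ Finset.range n, centeredPowers P'[X] (centralMoment X · P') (S k ω))) atTop
      (id : EuclideanSpace ℝ (Fin 4) → EuclideanSpace ℝ (Fin 4)) (fun _ => P)
      (multivariateGaussian 0 (sigma (centralMoment X · P'))) := by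
  have hm := measurable_centeredPowers P'[X] (centralMoment X · P')
  have hcoord (i : Fin 4) : Measurable fun x : EuclideanSpace ℝ (Fin 4) => x i := by fun_prop
  have hid (i : Fin 4) := (hident 0).comp ((hcoord i).comp hm)
  have hclt := tendstoInDistribution_multivariateGaussian (P := P)
    (W := fun k ω => centeredPowers P'[X] (centralMoment X · P') (S k ω))
    (S := sigma (centralMoment X · P')) (hindep.comp (fun _ => _) fun _ => hm)
    (fun i => ((hident i).trans (hident 0).symm).comp hm)
    (fun i => (hid i).memLp_iff.2 (memLp_centeredPowers hX i))
    (fun i => (hid i).integral_eq.trans (integral_centeredPowers hX i))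
    (fun i j => ((hident 0).comp (((hcoord i).comp hm).mul ((hcoord j).comp hm))).integral_eq.trans
      (integral_centeredPowers_mul hX i j))
  convert! hclt using 3 with n ω
  rw [smul_smul, ← div_eq_mul_inv, Real.sqrt_div_self', one_div]

lemma phi_asymptoticallyNormal {φ : EuclideanSpace ℝ (Fin 4) → EuclideanSpace ℝ (Fin 4)}
    {J : Matrix (Fin 4) (Fin 4) ℝ} {w : EuclideanSpace ℝ (Fin 4)}
    {Q : ℕ → Ω → EuclideanSpace ℝ (Fin 4)} (hQ : ∀ n, AEMeasurable (Q n) P)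
    (hindep : iIndepFun S P) (hident : ∀ i, IdentDistrib (S i) X P P')
    (hX : MemLp (fun ω => X ω - P'[X]) 8 P')
    (hθ : theta (centralMoment X 2 P') (centralMoment X 3 P') (centralMoment X 4 P') ≠ 0)
    (hφ : HasFDerivAt φ (Matrix.toEuclideanCLM (𝕜 := ℝ) J)
      !₂[P'[X], centralMoment X 2 P', centralMoment X 3 P', centralMoment X 4 P'])
    (hw : φ !₂[P'[X], centralMoment X 2 P', centralMoment X 3 P', centralMoment X 4 P'] = w)
    (hQφ : ∀ n, ∀ᵐ ω ∂P, ThreeDistinct S n ω → Q n ω = φ (sampleVector S n ω)) :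
    AsymptoticallyNormal P Q w (asymptoticCovariance J
      (jPsi (centralMoment X 2 P') (centralMoment X 3 P')) (sigma (centralMoment X · P'))) := by
  set c : ℕ → ℝ := (centralMoment X · P')
  have hS : (sigma c).PosSemidef :=
    ProbabilityTheory.posSemidef_of_integral_mul (memLp_centeredPowers hX)
      (integral_centeredPowers_mul hX)
  have hD : (asymptoticCovariance J (jPsi (c 2) (c 3)) (sigma c)).PosSemidef := by
    simpa [asymptoticCovariance] using hS.mul_mul_conjTranspose_same (J * jPsi (c 2) (c 3))
  have hU := tendstoInDistribution_centeredPowers hindep hident hX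
  set U : ℕ → Ω → EuclideanSpace ℝ (Fin 4) := fun n ω =>
    (n : ℝ)⁻¹ • ∑ k ∈ Finset.range n, centeredPowers P'[X] c (S k ω)
  set v₀ : EuclideanSpace ℝ (Fin 4) := !₂[0, c 2, c 3, c 4] with hv₀
  -- `p` sends the centred averages U n to the sample vector, and 0 to the true moments, so the
  -- delta method is applied to φ ∘ p at 0.
  set p : EuclideanSpace ℝ (Fin 4) → EuclideanSpace ℝ (Fin 4) := fun u =>
    psi (u + v₀) + !₂[P'[X], 0, 0, 0] with hp
  have hp0 : p 0 = !₂[P'[X], c 2, c 3, c 4] := by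
    ext i
    fin_cases i <;> simp [hp, hv₀, psi]
  have hpd : HasFDerivAt p (Matrix.toEuclideanCLM (𝕜 := ℝ) (jPsi (c 2) (c 3))) 0 := by
    have hψ : HasFDerivAt psi (Matrix.toEuclideanCLM (𝕜 := ℝ) (jPsi (c 2) (c 3))) (0 + v₀) := by
      rw [zero_add]
      exact hasFDerivAt_psi _ _ _
    exact ((hasFDerivAt_comp_add_right v₀).2 hψ).add_const _
  have hh : HasFDerivAt (φ ∘ p) (Matrix.toEuclideanCLM (𝕜 := ℝ) (J * jPsi (c 2) (c 3))) 0 := by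
    rw [map_mul]
    exact HasFDerivAt.comp 0 (hp0 ▸ hφ) hpd
  have hsample (n : ℕ) (hn : n ≠ 0) (ω : Ω) : sampleVector S n ω = p (U n ω) :=
    sampleVector_eq_psi hn _ centralMoment_one
  have hθp : ∀ᶠ u in 𝓝 (0 : EuclideanSpace ℝ (Fin 4)), theta (p u 1) (p u 2) (p u 3) ≠ 0 := by
    have hcont : ContinuousAt (fun u => theta (p u 1) (p u 2) (p u 3)) 0 := by
      have hi (i : Fin 4) : ContinuousAt (fun u => p u i) 0 :=
        (hasStrictFDerivAt_coord i _).continuousAt.comp hpd.continuousAt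
      have h1 := hi 1
      have h2 := hi 2
      have h3 := hi 3
      unfold theta
      fun_prop
    refine hcont.eventually_ne ?_
    rw [hp0]
    exact hθ
  obtain ⟨r, hr, hball⟩ := Metric.eventually_nhds_iff.1 hθp
  -- If ‖U n‖ < r then Θ̂ ≠ 0, so three distinct values occur and Q n is a.s. given by φ. The bad
  -- event thus lies a.s. in {r ≤ ‖U n‖}.
  have hQU : Tendsto (fun n => P {ω | Q n ω ≠ (φ ∘ p) (U n ω)}) atTop (𝓝 0) := by
    refine tendsto_of_tendsto_of_tendsto_of_le_of_le' tendsto_const_nhds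
      (hU.tendsto_measure_le_norm_of_sqrt_smul hr) (Eventually.of_forall fun _ => zero_le)
      ((eventually_ne_atTop 0).mono fun n hn => measure_mono_ae ?_)
    filter_upwards [hQφ n] with ω hω hne
    by_contra hlt
    refine hne ?_
    have hlt' : ‖U n ω‖ < r := not_le.1 hlt
    rw [hω, hsample n hn, Function.comp_apply]
    by_contra h3
    refine hball (y := U n ω) (by simpa using hlt') ?_
    rw [← hsample n hn]
    exact theta_sample_eq_zero hn h3
  have hmain := hU.delta_method hh hQ hQU
  have hw' : (φ ∘ p) 0 = w := by rw [Function.comp_apply, hp0, hw]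
  rw [hw'] at hmain
  refine ⟨hD, hmain.of_map_eq aemeasurable_id ?_⟩
  rw [Function.comp_id, Measure.map_id]
  exact ProbabilityTheory.map_toEuclideanCLM_multivariateGaussian hS _

end Asymptotics

end Pearson

theorem mainTheorem2
    {Ω Ω' : Type*} [MeasurableSpace Ω] [MeasurableSpace Ω']
    (P : Measure Ω) [IsProbabilityMeasure P] (P' : Measure Ω') [IsProbabilityMeasure P']
    (X : Ω' → ℝ) (S : ℕ → Ω → ℝ)
    (hindep : iIndepFun S P) (hident : ∀ i, IdentDistrib (S i) X P P')
    (h8 : Integrable (fun ω => X ω ^ 8) P')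
    (μ : ℕ → ℝ) (hμ : ∀ k, μ k = centralMoment X k P')
    (δ β γ : ℝ)
    (Q : ℕ → Ω → EuclideanSpace ℝ (Fin 4)) (hQ : ∀ n, AEMeasurable (Q n) P) :
    (Pearson.DiscreteForm P' X δ β γ →
      (∀ n, ∀ᵐ ω ∂P, Pearson.ThreeDistinct S n ω →
        Q n ω = Pearson.phiDiscrete (Pearson.sampleVector S n ω)) →
      HasFDerivAt Pearson.psi
        (Matrix.toEuclideanCLM (𝕜 := ℝ) (Pearson.jPsi (μ 2) (μ 3))) !₂[0, μ 2, μ 3, μ 4] ∧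
      HasFDerivAt Pearson.phiDiscrete
        (Matrix.toEuclideanCLM (𝕜 := ℝ) (Pearson.jPhiDiscrete (μ 2) (μ 3) (μ 4)))
        !₂[P'[X], μ 2, μ 3, μ 4] ∧
      Pearson.AsymptoticallyNormal P Q !₂[P'[X], δ, β, γ]
        (Pearson.asymptoticCovariance (Pearson.jPhiDiscrete (μ 2) (μ 3) (μ 4))
          (Pearson.jPsi (μ 2) (μ 3)) (Pearson.sigma μ))) ∧
    (∀ f : ℝ → ℝ, Pearson.ContinuousForm P' X f δ β γ →
      (∀ n, ∀ᵐ ω ∂P, Pearson.ThreeDistinct S n ω →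
        Q n ω = Pearson.phiContinuous (Pearson.sampleVector S n ω)) →
      HasFDerivAt Pearson.psi
        (Matrix.toEuclideanCLM (𝕜 := ℝ) (Pearson.jPsi (μ 2) (μ 3))) !₂[0, μ 2, μ 3, μ 4] ∧
      HasFDerivAt Pearson.phiContinuous
        (Matrix.toEuclideanCLM (𝕜 := ℝ) (Pearson.jPhiContinuous (μ 2) (μ 3) (μ 4)))
        !₂[P'[X], μ 2, μ 3, μ 4] ∧
      Pearson.AsymptoticallyNormal P Q !₂[P'[X], δ, β, γ]
        (Pearson.asymptoticCovariance (Pearson.jPhiContinuous (μ 2) (μ 3) (μ 4))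
          (Pearson.jPsi (μ 2) (μ 3)) (Pearson.sigma μ))) := by
  obtain rfl : μ = fun k => centralMoment X k P' := funext hμ
  have hX : AEMeasurable X P' := (hident 0).aemeasurable_snd
  have hL := Pearson.memLp_sub_const_of_integrable_pow hX h8 P'[X]
  refine ⟨fun h hQφ => ?_, fun f h hQφ => ?_⟩
  · have hθ := (Pearson.theta_centralMoment_pos hL h.not_ae_quadratic).ne'
    have hφ := Pearson.hasFDerivAt_phiDiscrete (m := P'[X]) hθ
    exact ⟨Pearson.hasFDerivAt_psi _ _ _, hφ, Pearson.phi_asymptoticallyNormal hQ hindep hident hL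
      hθ hφ (h.phiDiscrete_eq hL hθ) hQφ⟩
  · have hθ := (Pearson.theta_centralMoment_pos hL h.not_ae_quadratic).ne'
    have hφ := Pearson.hasFDerivAt_phiContinuous (m := P'[X]) hθ
    exact ⟨Pearson.hasFDerivAt_psi _ _ _, hφ, Pearson.phi_asymptoticallyNormal hQ hindep hident hL
      hθ hφ (h.phiContinuous_eq hL hθ) hQφ⟩
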